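/- Let $G(n,p)$ denote the random graph on $n$ labelled vertices in which every pair of distinct vertices is joined independently with probability $p$, and $G(n,m)$ the uniformly random simple graph on $n$ labelled vertices with exactly $m$ edges. For $c\ge 0$ let $\alpha_{\mathrm{crit}}(c)$ be the critical density of independent sets, i.e. the supremum of all $\alpha$ such that $G(n,p=c/n)$ has an independent set of size $\alpha n$ with probability tending to $1$ as $n\to\infty$; and for $\alpha>0$ let $c_{\mathrm{crit}}(\alpha)=\sup\{c\ge 0:\alpha_{\mathrm{crit}}(c)\ge\alpha\}\in[-\infty,\infty]$. Then for every constant $x>4/\mathrm e$ there is $\alpha_0>0$ such that for all $\alpha\in(0,\alpha_0)$ $$c_{\mathrm{crit}}(\alpha)\;\ge\;2\,\frac{\ln(1/\alpha)+1}{\alpha}-\frac{x}{\sqrt\alpha},$$ and, moreover, for every constant $c$ with $0\le c\le 2\,\frac{\ln(1/\alpha)+1}{\alpha}-\frac{x}{\sqrt\alpha}$, the random graph $G(n,m=cn/2)$ has an independent set of size $\alpha n$ with probability tending to $1$ as $n\to\infty$. (Here $\alpha n$ and $cn/2$ are rounded up to integers.) -/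

import Mathlib

open Filter Topology MeasureTheory

/-- The event that a graph on `n` labelled vertices has an independent set of size `α n`, rounded
up to an integer. -/
def HasIndepSetOfDensity (n : ℕ) (α : ℝ) : Set (SimpleGraph (Fin n)) :=
  {G | ∃ S : Finset (Fin n), G.IsNIndepSet ⌈α * n⌉₊ S}

/-- The random graph `G(n, p = c / n)`: each pair of distinct vertices is an edge independently
with probability `c / n`, truncated to `[0, 1]` (this only matters for the finitely many `n < c`,
when `0 ≤ c`). -/
noncomputable def gnp (n : ℕ) (c : ℝ) : Measure (SimpleGraph (Fin n)) :=
  SimpleGraph.binomialRandom (Fin n) (Set.projIcc 0 1 zero_le_one (c / n))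

/-- The random graph `G(n, m)`: uniform over all simple graphs on `n` labelled vertices with
exactly `m` edges. -/
noncomputable def gnm (n m : ℕ) : Measure (SimpleGraph (Fin n)) :=
  ProbabilityTheory.uniformOn {G : SimpleGraph (Fin n) | G.edgeSet.ncard = m}

/-- `a` is the threshold density for independent sets in `G(n, p = c / n)`. -/
def IsIndepThreshold (c a : ℝ) : Prop :=
  (∀ α < a, Tendsto (fun n : ℕ => (gnp n c).real (HasIndepSetOfDensity n α)) atTop (𝓝 1)) ∧
  (∀ α > a, Tendsto (fun n : ℕ => (gnp n c).real (HasIndepSetOfDensity n α)) atTop (𝓝 0))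

/-- The critical density: the supremum of all `α` such that `G(n, p = c / n)` has an independent
set of size `α n` with high probability. The set is nonempty (it contains `0`) and bounded above
by `1`. -/
noncomputable def alphaCrit (c : ℝ) : ℝ :=
  sSup {α : ℝ | Tendsto (fun n : ℕ => (gnp n c).real (HasIndepSetOfDensity n α)) atTop (𝓝 1)}

/-- If there is a threshold density, then it is `alphaCrit c`. -/
theorem IsIndepThreshold.alphaCrit_eq {c a : ℝ} (h : IsIndepThreshold c a) :
    alphaCrit c = a := by
  refine csSup_eq_of_forall_le_of_forall_lt_exists_gt ⟨a - 1, h.1 _ (by linarith)⟩ ?_ ?_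
  · intro α hα
    by_contra hlt
    exact zero_ne_one (tendsto_nhds_unique (h.2 α (not_le.mp hlt)) hα)
  · intro w hw
    exact ⟨(w + a) / 2, h.1 _ (by linarith), by linarith⟩

/-- The critical average degree `sup {c ≥ 0 : alphaCrit c ≥ α}`, as an extended real number. -/
noncomputable def cCrit (α : ℝ) : EReal :=
  sSup ((fun c : ℝ => (c : EReal)) '' {c : ℝ | 0 ≤ c ∧ α ≤ alphaCrit c})

/-- The lower bound `2 (ln (1/α) + 1) / α - x / √α`. -/
noncomputable def cLower (x α : ℝ) : ℝ :=
  2 * ((Real.log (1 / α) + 1) / α) - x / √α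

/-!
The proof applies a weighted second moment method to `G(n, d / n)` and then boosts the resulting
weak lower bound by concentration of the independence number.

*Weights.* Let `S` be a set of `k = a n` vertices and `h` its indicator, centred at `a` and scaled
to be `1` on `S`. The weight of `S` in a graph is the product of `1 - h u * h v` over the edges
`uv`. It vanishes if an edge lies inside `S`. Since `h` has mean zero, the expected weight is bounded
below by a positive constant, and the expected product of the weights of `S` and `T` is at most a
constant times `exp (n d / 2 * (b - a²)² / (1 - a)⁴)`, where `b n` is the size of `S ∩ T`
(`exp_le_prod_edge`, `prod_edge_le_exp`). So typical overlaps `b = a²` cost nothing, and the weight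
removes the correlation that defeats the unweighted second moment.

*Overlaps.* The proportion of pairs with overlap `b n` is at most `(n + 1) exp (-n J(a, b))`, where
`J` is a relative entropy (`overlapRate`, `choose_mul_choose_le`). For small `a`,
`J(a, b) ≥ d / 2 * (b - a²)² / (1 - a)⁴` holds for all `b ∈ [0, a]` as soon as
`d ≤ 2 (ln (1 / a) + 1) / a - x / √a` with `x > 4 / e` (`exists_le_overlapRate`). The critical
overlaps are `b = a - a ^ (3 / 2) u` with `u` of order one; there the inequality reads
`2 u ln u + x / 2 ≥ 0` up to lower order terms, and the minimum of `u ln u` is `-1 / e`. Hence, by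
Cauchy–Schwarz, an independent `k`-set exists with probability at least of order `n⁻²`
(`le_bernProb_indepSet`).

*Boosting and transfer.* The independence number changes by at most one when an edge is added, so
its deviations of order `n` have exponentially small probability (`bernExp_exp_le`). A probability
of order `n⁻²` therefore forces its mean above `k - o(n)`, and an independent set of any slightly
smaller density exists with high probability (`tendsto_bernProb_of_inv_sq_le`). The lost density is
paid for by running the argument with some `y ∈ (4 / e, x)` in place of `x`, which also gives a
degree `d > cLower x α`. Finally, `G(n, d / n)` has more than `c n / 2` edges with high probability
for `c < d`, and by the local LYM inequality the probability that `G(n, m)` has a property closed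
under removing edges decreases with `m`; this transfers the result to `G(n, m)`.
-/

/-! ### Independent random subsets and concentration -/

open Finset in
/-- Expectation of `f` over the random subset of `s` that contains each element independently with
probability `p`, written as a finite sum so that one can induct on `s`. -/
noncomputable def bernExp {E : Type*} [DecidableEq E] (p : ℝ) (s : Finset E)
    (f : Finset E → ℝ) : ℝ :=
  ∑ A ∈ s.powerset, (p ^ #A * (1 - p) ^ #(s \ A)) * f A

section BernExp

open Finset

variable {E : Type*} [DecidableEq E] {p : ℝ} {s : Finset E} {f g : Finset E → ℝ}

lemma bernExp_mono (hp0 : 0 ≤ p) (hp1 : p ≤ 1) (h : ∀ A ⊆ s, f A ≤ g A) :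
    bernExp p s f ≤ bernExp p s g := by
  have := sub_nonneg.2 hp1
  exact sum_le_sum fun A hA ↦ mul_le_mul_of_nonneg_left (h A (mem_powerset.1 hA)) (by positivity)

lemma bernExp_add : bernExp p s (fun A ↦ f A + g A) = bernExp p s f + bernExp p s g := by
  simp [bernExp, mul_add, sum_add_distrib]

lemma bernExp_const_mul (r : ℝ) : bernExp p s (fun A ↦ r * f A) = r * bernExp p s f := by
  simp only [bernExp, mul_sum]
  exact sum_congr rfl fun A _ ↦ by ring

lemma bernExp_sum {ι : Type*} (t : Finset ι) (F : ι → Finset E → ℝ) :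
    bernExp p s (fun A ↦ ∑ i ∈ t, F i A) = ∑ i ∈ t, bernExp p s (F i) := by
  simp only [bernExp, mul_sum]
  exact sum_comm

/-- Independence: the expectation of a product of edge weights factorises. -/
lemma bernExp_prod (w : E → ℝ) :
    bernExp p s (fun A ↦ ∏ e ∈ A, w e) = ∏ e ∈ s, (p * w e + (1 - p)) := by
  rw [prod_add]
  refine sum_congr rfl fun A _ ↦ ?_
  rw [prod_mul_distrib, prod_const, prod_const]
  ring

lemma bernExp_const (r : ℝ) : bernExp p s (fun _ ↦ r) = r := by
  have h := bernExp_prod (p := p) (s := s) (fun _ : E ↦ (1 : ℝ))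
  have h' := bernExp_const_mul (p := p) (s := s) (f := fun _ ↦ 1) r
  simp only [prod_const_one, mul_one, add_sub_cancel] at h h'
  rw [h', h, mul_one]

lemma bernExp_insert {e : E} (he : e ∉ s) :
    bernExp p (insert e s) f =
      bernExp p s (fun A ↦ (1 - p) * f A + p * f (insert e A)) := by
  rw [bernExp, sum_powerset_insert he, ← sum_add_distrib]
  refine sum_congr rfl fun A hA ↦ ?_
  have hA' : e ∉ A := fun h ↦ he (mem_powerset.1 hA h)
  rw [card_insert_of_notMem hA', insert_sdiff_of_notMem _ hA',
    card_insert_of_notMem (by simp [he]),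
    insert_sdiff_insert, sdiff_insert_of_notMem he]
  ring

lemma bernExp_card : bernExp p s (fun A ↦ (#A : ℝ)) = p * #s := by
  induction s using Finset.induction_on with
  | empty => simp [bernExp]
  | insert e s he ih =>
    rw [bernExp_insert he, card_insert_of_notMem he]
    have : bernExp p s (fun A ↦ (1 - p) * (#A : ℝ) + p * (#(insert e A) : ℝ)) =
        bernExp p s (fun A ↦ (#A : ℝ) + p) := by
      refine sum_congr rfl fun A hA ↦ ?_
      simp only [card_insert_of_notMem fun h ↦ he (mem_powerset.1 hA h)]
      push_cast
      ring
    rw [this, bernExp_add, ih, bernExp_const]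
    push_cast
    ring

/-- Cauchy–Schwarz. -/
lemma bernExp_mul_sq_le (hp0 : 0 ≤ p) (hp1 : p ≤ 1) :
    bernExp p s (fun A ↦ f A * g A) ^ 2 ≤
      bernExp p s (fun A ↦ f A ^ 2) * bernExp p s (fun A ↦ g A ^ 2) := by
  have := sub_nonneg.2 hp1
  refine sum_sq_le_sum_mul_sum_of_sq_le_mul _ (fun A _ ↦ ?_) (fun A _ ↦ ?_) fun A _ ↦ ?_
  · positivity
  · positivity
  · exact le_of_eq (by ring)

/-- A function that changes by at most `1` when one element is added is concentrated: its
centred moment generating function is sub-Gaussian near `0`, with variance proxy of order `p #s`. -/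
lemma bernExp_exp_le (hp0 : 0 ≤ p) (hp1 : p ≤ 1) {l : ℝ} (hl : |l| ≤ 1)
    (hf : ∀ A e, |f (insert e A) - f A| ≤ 1) :
    bernExp p s (fun A ↦ Real.exp (l * f A)) ≤
      Real.exp (l * bernExp p s f + #s * p * l ^ 2) := by
  induction s using Finset.induction_on generalizing f with
  | empty => simp [bernExp]
  | insert e s he ih =>
    have hp1' := sub_nonneg.2 hp1
    set h : Finset E → ℝ := fun A ↦ (1 - p) * f A + p * f (insert e A) with hh
    have hlip : ∀ A e, |h (insert e A) - h A| ≤ 1 := by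
      intro A e'
      have e1 : h (insert e' A) - h A = (1 - p) * (f (insert e' A) - f A) +
          p * (f (insert e' (insert e A)) - f (insert e A)) := by
        simp only [hh, Finset.insert_comm e e' A]
        ring
      have h1 := abs_le.1 (hf A e')
      have h2 := abs_le.1 (hf (insert e A) e')
      rw [e1, abs_le]
      constructor <;> nlinarith
    rw [bernExp_insert he, bernExp_insert he, card_insert_of_notMem he]
    have step : ∀ A, (1 - p) * Real.exp (l * f A) + p * Real.exp (l * f (insert e A)) ≤
        Real.exp (p * l ^ 2) * Real.exp (l * h A) := by
      intro A
      set D := f (insert e A) - f A with hD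
      have hDl : |l * D| ≤ 1 := by
        rw [abs_mul]
        exact mul_le_one₀ hl (abs_nonneg _) (hf A e)
      have hq := Real.abs_exp_sub_one_sub_id_le hDl
      have hq' := (abs_le.1 hq).2
      have hD2 : (l * D) ^ 2 ≤ l ^ 2 := by
        have : D ^ 2 ≤ 1 := (sq_le_one_iff_abs_le_one _).2 (hf A e)
        nlinarith [sq_nonneg l]
      have e2 : f (insert e A) = f A + D := by rw [hD]; ring
      have e3 : Real.exp (p * l ^ 2) * Real.exp (l * h A) =
          Real.exp (l * f A) * Real.exp (p * (l * D + l ^ 2)) := by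
        rw [← Real.exp_add, ← Real.exp_add]
        congr 1
        simp only [hh, e2]
        ring
      have e4 : (1 - p) * Real.exp (l * f A) + p * Real.exp (l * f (insert e A)) =
          Real.exp (l * f A) * (1 + p * (Real.exp (l * D) - 1)) := by
        rw [e2, mul_add, Real.exp_add]
        ring
      rw [e3, e4]
      refine mul_le_mul_of_nonneg_left ?_ (Real.exp_nonneg _)
      calc 1 + p * (Real.exp (l * D) - 1) ≤ p * (l * D + l ^ 2) + 1 := by nlinarith
        _ ≤ _ := Real.add_one_le_exp _
    calc _ ≤ bernExp p s (fun A ↦ Real.exp (p * l ^ 2) * Real.exp (l * h A)) :=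
          bernExp_mono hp0 hp1 fun A _ ↦ step A
      _ = Real.exp (p * l ^ 2) * bernExp p s (fun A ↦ Real.exp (l * h A)) :=
          bernExp_const_mul _
      _ ≤ Real.exp (p * l ^ 2) * Real.exp (l * bernExp p s h + #s * p * l ^ 2) :=
          mul_le_mul_of_nonneg_left (ih hlip) (Real.exp_nonneg _)
      _ = _ := by
          rw [← Real.exp_add]
          congr 1
          push_cast
          ring

/-- Probability of `Q` for the random subset of `s` that contains each element independently with
probability `p`. -/
noncomputable def bernProb (p : ℝ) (s : Finset E) (Q : Finset E → Prop) : ℝ :=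
  open Classical in bernExp p s (fun A ↦ if Q A then 1 else 0)

variable {Q : Finset E → Prop}

lemma bernProb_add_bernProb_not : bernProb p s Q + bernProb p s (fun A ↦ ¬ Q A) = 1 := by
  classical
  rw [bernProb, bernProb, ← bernExp_add]
  refine Eq.trans ?_ (bernExp_const (p := p) (s := s) 1)
  congr 1
  ext A
  by_cases h : Q A <;> simp [h]

/-- Chernoff bound for functions with differences bounded by `1`; the sign of `l` decides which
tail is bounded. -/
lemma bernProb_le_exp (hp0 : 0 ≤ p) (hp1 : p ≤ 1) {l t : ℝ} (hl : |l| ≤ 1)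
    (hf : ∀ A e, |f (insert e A) - f A| ≤ 1)
    (hQ : ∀ A ⊆ s, Q A → t ≤ l * (f A - bernExp p s f)) :
    bernProb p s Q ≤ Real.exp (-t + #s * p * l ^ 2) := by
  classical
  calc bernProb p s Q
      ≤ bernExp p s (fun A ↦ Real.exp (-t - l * bernExp p s f) * Real.exp (l * f A)) := by
        refine bernExp_mono hp0 hp1 fun A hA ↦ ?_
        rw [← Real.exp_add]
        split_ifs with h
        · have := hQ A hA h
          exact Real.one_le_exp (by linarith)
        · positivity
    _ = Real.exp (-t - l * bernExp p s f) * bernExp p s (fun A ↦ Real.exp (l * f A)) :=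
        bernExp_const_mul _
    _ ≤ Real.exp (-t - l * bernExp p s f) *
          Real.exp (l * bernExp p s f + #s * p * l ^ 2) :=
        mul_le_mul_of_nonneg_left (bernExp_exp_le hp0 hp1 hl hf) (Real.exp_nonneg _)
    _ = _ := by
        rw [← Real.exp_add]
        congr 1
        ring

end BernExp

/-! ### The overlap inequality -/

/-- The rate `J(a, b)` at which pairs of sets of density `a` with intersection of density `b` are
exponentially rarer than all pairs: the relative entropy of `(b, a-b, a-b, 1-2a+b)` with respect to
`(a², a(1-a), a(1-a), (1-a)²)`, written with `x log x`. -/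
noncomputable def overlapRate (a b : ℝ) : ℝ :=
  b * Real.log b + 2 * ((a - b) * Real.log (a - b)) + (1 - 2 * a + b) * Real.log (1 - 2 * a + b)
    - 2 * (a * Real.log a) - 2 * ((1 - a) * Real.log (1 - a))

open InformationTheory in
lemma mul_klFun_div {x y : ℝ} (hy : 0 < y) (hx : 0 ≤ x) :
    y * klFun (x / y) = x * Real.log x - x * Real.log y - x + y := by
  rcases hx.eq_or_lt with rfl | hx
  · simp [klFun]
  · rw [klFun, Real.log_div hx.ne' hy.ne']
    field_simp
    ring

open InformationTheory in
lemma overlapRate_eq {a b : ℝ} (ha : 0 < a) (ha1 : a < 1 / 2) (hb : 0 ≤ b) (hba : b ≤ a) :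
    overlapRate a b = a ^ 2 * klFun (b / a ^ 2) +
      2 * (a * (1 - a) * klFun ((a - b) / (a * (1 - a)))) +
      (1 - a) ^ 2 * klFun ((1 - 2 * a + b) / (1 - a) ^ 2) := by
  have h1 : 0 < 1 - a := by linarith
  rw [mul_klFun_div (by positivity) hb, mul_klFun_div (by positivity) (by linarith),
    mul_klFun_div (by positivity) (by linarith), Real.log_mul ha.ne' h1.ne', Real.log_pow,
    Real.log_pow, overlapRate]
  push_cast
  ring

open InformationTheory in
lemma sq_le_klFun {t : ℝ} (ht : 0 ≤ t) (ht9 : t ≤ 9) : (t - 1) ^ 2 / 16 ≤ klFun t := by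
  rcases ht.eq_or_lt with rfl | ht
  · norm_num [klFun]
  obtain ⟨r, hr, rfl⟩ : ∃ r, 0 < r ∧ t = r ^ 2 := ⟨√t, by positivity, by simp [ht.le]⟩
  have hr3 : r ≤ 3 := by nlinarith
  have hlog : 1 - r⁻¹ ≤ Real.log r := Real.one_sub_inv_le_log_of_pos hr
  have h2 : r - 1 ≤ r * Real.log r := by
    have := mul_le_mul_of_nonneg_left hlog hr.le
    rwa [mul_sub, mul_one, mul_inv_cancel₀ hr.ne'] at this
  rw [klFun, Real.log_pow]
  push_cast
  -- `klFun (r ^ 2) ≥ (r - 1) ^ 2`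
  nlinarith [mul_nonneg (sq_nonneg (r - 1)) (by nlinarith : 0 ≤ 16 - (r + 1) ^ 2)]

lemma mul_log_le_mul_log {u T : ℝ} (hu : Real.exp 1 ≤ u) (huT : u ≤ T) :
    u * Real.log T ≤ T * Real.log u := by
  have hu0 := (Real.exp_pos 1).trans_le hu
  have := Real.log_div_self_antitoneOn (Set.mem_ofPred.2 hu) (Set.mem_ofPred.2 (hu.trans huT)) huT
  rw [div_le_div_iff₀ (hu0.trans_le huT) hu0] at this
  linarith

open InformationTheory in
lemma mul_sq_le_klFun {q t T : ℝ} (ht : 0 ≤ t) (htT : t ≤ T) (hq : 0 ≤ q) (hq1 : q ≤ 1 / 16)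
    (hT : q * T ≤ Real.log T - 1) : q * (t - 1) ^ 2 ≤ klFun t := by
  rcases le_total t 9 with h9 | h9
  · have := sq_le_klFun ht h9
    nlinarith [sq_nonneg (t - 1)]
  have he := Real.exp_one_lt_d9
  have he0 := Real.exp_pos 1
  have hT0 : 0 < T := by linarith
  have ht0 : 0 < t := by linarith
  have h := mul_log_le_mul_log (u := t / Real.exp 1) (T := T / Real.exp 1)
    (by rw [le_div_iff₀ he0]; nlinarith) (by gcongr)
  rw [Real.log_div hT0.ne' he0.ne', Real.log_div ht0.ne' he0.ne', Real.log_exp,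
    div_mul_eq_mul_div, div_mul_eq_mul_div, div_le_div_iff_of_pos_right he0] at h
  have h1 : q * t ≤ Real.log t - 1 := by
    have : t * (q * T) ≤ T * (Real.log t - 1) :=
      (mul_le_mul_of_nonneg_left hT ht).trans h
    nlinarith
  rw [klFun]
  nlinarith [mul_le_mul_of_nonneg_left h1 ht]

/-- The rescaled inequality near maximal overlap `b = a - a ^ (3 / 2) u`, with `s = √a`. The minimum
`-2 / e` of `2 u log u` is what forces `x > 4 / e`. -/
lemma near_full_overlap {x s u M : ℝ} (hs : 0 < s) (hu : 0 ≤ u) (hus : s * u ≤ 1 / 2)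
    (hM : M = 1 - 2 * Real.log s) (hM20 : 20 ≤ M) (hx : 0 < x)
    (hsm : 14 * (s * M) + 3 * x * s ≤ x / 2 - 2 / Real.exp 1) :
    5 * (s * M) ≤ 2 * (u * Real.log u) - s * u ^ 2 * M + x / 2 * (1 - s * u) ^ 2 := by
  have he0 := Real.exp_pos 1
  have he := Real.exp_one_lt_d9
  have hsM : 0 < s * M := by positivity
  rcases le_total u 3 with h3 | h3
  · have h1 : -(1 / Real.exp 1) ≤ u * Real.log u := by
      rcases hu.eq_or_lt with rfl | hu
      · simp [he0.le]
      have := Real.one_sub_inv_le_log_of_pos (mul_pos he0 hu)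
      rw [Real.log_mul he0.ne' hu.ne', Real.log_exp, mul_inv] at this
      have h2 := mul_le_mul_of_nonneg_left this hu.le
      have h3 : u * (1 - (Real.exp 1)⁻¹ * u⁻¹) = u - 1 / Real.exp 1 := by
        field_simp
      nlinarith
    have h2 : s * u ^ 2 * M ≤ 9 * (s * M) := by
      have : u ^ 2 ≤ 9 := by nlinarith
      nlinarith
    have h4 : x / 2 * (1 - 6 * s) ≤ x / 2 * (1 - s * u) ^ 2 := by
      have : 1 - 6 * s ≤ (1 - s * u) ^ 2 := by nlinarith [sq_nonneg (s * u)]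
      nlinarith
    have h5 : 2 / Real.exp 1 = 2 * (1 / Real.exp 1) := by ring
    nlinarith
  · have h2s : u ≤ 1 / (2 * s) := by
      rw [le_div_iff₀ (by positivity)]
      linarith
    have h := mul_log_le_mul_log (by linarith) h2s
    have hl2 := Real.log_two_lt_d9
    have e1 : Real.log (1 / (2 * s)) = (M - 1) / 2 - Real.log 2 := by
      rw [one_div, Real.log_inv, Real.log_mul two_ne_zero hs.ne', hM]
      ring
    rw [e1, div_mul_eq_mul_div, one_mul, le_div_iff₀ (by positivity)] at h
    have h1 : 3 / 4 * (s * u * M) ≤ 2 * Real.log u - s * u * M := by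
      have : 0 < s * u := by positivity
      nlinarith
    have h6 := mul_le_mul_of_nonneg_left h1 hu
    have h7 : 9 * (s * M) ≤ u ^ 2 * (s * M) := by
      have : 9 ≤ u ^ 2 := by nlinarith
      nlinarith
    have h8 : 0 ≤ x / 2 * (1 - s * u) ^ 2 := by positivity
    nlinarith

lemma sq_div_le_of_large_overlap {a r : ℝ} (ha : 0 < a) (ha1 : a ≤ 1 / 20) (hr : 0 ≤ r)
    (hr1 : r ≤ 1 / 2) :
    (a * (1 - r) - a ^ 2) ^ 2 / (1 - a) ^ 4 ≤ a ^ 2 * ((1 - r) ^ 2 * (1 + 4 * a)) := by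
  have h1a : 0 < 1 - a := by linarith
  have e2 : (1 - r - a) ^ 2 ≤ ((1 - r) * (1 - a)) ^ 2 := by
    apply pow_le_pow_left₀ (by linarith)
    nlinarith [mul_nonneg hr ha.le]
  have e4 : 1 ≤ (1 + 4 * a) * (1 - a) ^ 2 := by
    have : (1 + 4 * a) * (1 - a) ^ 2 = 1 + a * (2 - 7 * a) + 4 * a ^ 3 := by ring
    have h : 0 ≤ a * (2 - 7 * a) := mul_nonneg ha.le (by linarith)
    rw [this]
    linarith [pow_pos ha 3]
  rw [div_le_iff₀ (by positivity)]
  calc (a * (1 - r) - a ^ 2) ^ 2 = a ^ 2 * (1 - r - a) ^ 2 := by ring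
    _ ≤ a ^ 2 * ((1 - r) * (1 - a)) ^ 2 := by gcongr
    _ = a ^ 2 * ((1 - r) ^ 2 * (1 - a) ^ 2) * 1 := by ring
    _ ≤ a ^ 2 * ((1 - r) ^ 2 * (1 - a) ^ 2) * ((1 + 4 * a) * (1 - a) ^ 2) := by gcongr
    _ = _ := by ring

open InformationTheory in
lemma le_overlapRate_of_large_overlap {a r : ℝ} (ha : 0 < a) (ha1 : a ≤ 1 / 20) (hr : 0 ≤ r)
    (hr1 : r ≤ 1 / 2) :
    a * ((1 - r) * (1 - Real.log a) - r + 2 * (r * Real.log r) - a) ≤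
      overlapRate a (a * (1 - r)) := by
  have h1a : 0 < 1 - a := by linarith
  have hb : 0 ≤ a * (1 - r) := mul_nonneg ha.le (by linarith)
  have hba : a - a * (1 - r) = a * r := by ring
  have hba' : 0 ≤ a * r := by positivity
  have k3 : 0 ≤ (1 - a) ^ 2 * klFun ((1 - 2 * a + a * (1 - r)) / (1 - a) ^ 2) :=
    mul_nonneg (by positivity) (klFun_nonneg (div_nonneg (by linarith) (by positivity)))
  have hlog1 : Real.log (1 - a) ≤ 0 := Real.log_nonpos h1a.le (by linarith)
  have hentr : -r ≤ (1 - r) * Real.log (1 - r) := by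
    have := klFun_nonneg (x := 1 - r) (by linarith)
    rw [klFun] at this
    linarith
  have hrlog : (a * r) * Real.log (a * r) = a * (r * Real.log a + r * Real.log r) := by
    rcases hr.eq_or_lt with rfl | hr
    · simp
    rw [Real.log_mul ha.ne' hr.ne']
    ring
  rw [overlapRate_eq ha (by linarith) hb (by linarith)]
  refine le_trans ?_ (le_add_of_nonneg_right k3)
  rw [mul_klFun_div (by positivity) hb, hba, mul_klFun_div (by positivity) hba',
    hrlog, Real.log_mul ha.ne' h1a.ne', Real.log_mul ha.ne' (by linarith : 1 - r ≠ 0),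
    Real.log_pow]
  push_cast
  have h1 := mul_le_mul_of_nonneg_left hentr ha.le
  have h2 : a * r * Real.log (1 - a) ≤ 0 := mul_nonpos_of_nonneg_of_nonpos hba' hlog1
  linarith

open InformationTheory in
/-- The exponent of the second moment is nonpositive for all overlaps, under explicit smallness
conditions on `a`. -/
lemma le_overlapRate_of_small {x a b c M : ℝ} (hx : 0 < x) (ha : 0 < a) (ha1 : a ≤ 1 / 20)
    (hM : M = Real.log (1 / a) + 1) (hM20 : 20 ≤ M) (haM : a * M ≤ 1 / 20)
    (hsm : 14 * (√a * M) + 3 * x * √a ≤ x / 2 - 2 / Real.exp 1)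
    (hb : 0 ≤ b) (hba : b ≤ a) (hc : 0 ≤ c) (hcx : c ≤ cLower x a) :
    c / 2 * ((b - a ^ 2) ^ 2 / (1 - a) ^ 4) ≤ overlapRate a b := by
  have h1a : 0 < 1 - a := by linarith
  obtain ⟨s, hs, rfl⟩ : ∃ s, 0 < s ∧ a = s ^ 2 := ⟨√a, by positivity, by simp [ha.le]⟩
  rw [Real.sqrt_sq hs.le] at hsm
  rw [cLower, Real.sqrt_sq hs.le, ← hM] at hcx
  have hMs : M = 1 - 2 * Real.log s := by
    rw [hM, one_div, Real.log_inv, Real.log_pow]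
    push_cast
    ring
  have hca : c / 2 * s ^ 2 ≤ M - x / 2 * s := by
    have : c * s ^ 2 ≤ (2 * (M / s ^ 2) - x / s) * s ^ 2 := by gcongr
    have e : (2 * (M / s ^ 2) - x / s) * s ^ 2 = 2 * M - x * s := by field_simp
    linarith
  have hcM : c / 2 * s ^ 2 ≤ M := by nlinarith
  have k2 : 0 ≤ 2 * (s ^ 2 * (1 - s ^ 2) * klFun ((s ^ 2 - b) / (s ^ 2 * (1 - s ^ 2)))) :=
    mul_nonneg (by positivity) (mul_nonneg (by positivity)
      (klFun_nonneg (div_nonneg (by linarith) (by positivity))))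
  have k3 : 0 ≤ (1 - s ^ 2) ^ 2 * klFun ((1 - 2 * s ^ 2 + b) / (1 - s ^ 2) ^ 2) :=
    mul_nonneg (by positivity) (klFun_nonneg (div_nonneg (by linarith) (by positivity)))
  have hJ := overlapRate_eq ha (by linarith) hb hba
  rcases le_total b (s ^ 2 / 2) with hb2 | hb2
  · -- small overlap: the first relative entropy term suffices
    set t := b / (s ^ 2) ^ 2 with ht
    have hbt : b = (s ^ 2) ^ 2 * t := by rw [ht]; field_simp
    have h4 : 4 / 5 ≤ (1 - s ^ 2) ^ 4 := by
      have := one_add_mul_le_pow (a := -s ^ 2) (by linarith) 4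
      push_cast at this
      calc (4 / 5 : ℝ) ≤ 1 + 4 * (-s ^ 2) := by linarith
        _ ≤ _ := by rw [sub_eq_add_neg]; exact this
    have hl2 := Real.log_two_lt_d9
    have key : 5 / 4 * (s ^ 2 * M) * (t - 1) ^ 2 ≤ klFun t := by
      refine mul_sq_le_klFun (T := 1 / (2 * s ^ 2)) (by positivity) ?_ (by positivity)
        (by linarith) ?_
      · rw [ht, div_le_div_iff₀ (by positivity) (by positivity)]
        nlinarith
      · have : 5 / 4 * (s ^ 2 * M) * (1 / (2 * s ^ 2)) = 5 / 8 * M := by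
          field_simp
          ring
        rw [this, one_div, Real.log_inv, Real.log_mul two_ne_zero ha.ne', Real.log_pow]
        push_cast
        linarith
    have h5 : ((b - (s ^ 2) ^ 2) ^ 2 / (1 - s ^ 2) ^ 4) ≤
        5 / 4 * ((s ^ 2) ^ 4 * (t - 1) ^ 2) := by
      rw [div_le_iff₀ (by positivity)]
      have : (b - (s ^ 2) ^ 2) ^ 2 = (s ^ 2) ^ 4 * (t - 1) ^ 2 := by rw [hbt]; ring
      rw [this]
      have : 0 ≤ (s ^ 2) ^ 4 * (t - 1) ^ 2 := by positivity
      nlinarith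
    calc _ ≤ c / 2 * (5 / 4 * ((s ^ 2) ^ 4 * (t - 1) ^ 2)) := by gcongr
      _ = (c / 2 * s ^ 2) * (5 / 4 * ((s ^ 2) ^ 3 * (t - 1) ^ 2)) := by ring
      _ ≤ M * (5 / 4 * ((s ^ 2) ^ 3 * (t - 1) ^ 2)) := by gcongr
      _ = (s ^ 2) ^ 2 * (5 / 4 * (s ^ 2 * M) * (t - 1) ^ 2) := by ring
      _ ≤ (s ^ 2) ^ 2 * klFun t := by gcongr
      _ ≤ _ := by rw [hJ]; linarith
  · -- large overlap: `b = a (1 - s u)`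
    obtain ⟨u, hu, hbu⟩ : ∃ u, 0 ≤ u ∧ b = s ^ 2 * (1 - s * u) := by
      refine ⟨(s ^ 2 - b) / s ^ 3, div_nonneg (by linarith) (by positivity), ?_⟩
      field_simp
      ring
    have hsu : s * u ≤ 1 / 2 := by
      by_contra! h
      nlinarith
    have hsu0 : 0 ≤ s * u := by positivity
    have hnear := near_full_overlap hs hu hsu hMs hM20 hx hsm
    have hup : c / 2 * ((b - (s ^ 2) ^ 2) ^ 2 / (1 - s ^ 2) ^ 4) ≤
        s ^ 2 * ((M - x / 2 * s) * (1 - s * u) ^ 2 + 4 * (s ^ 2 * M)) := by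
      have e3 := sq_div_le_of_large_overlap ha (by linarith) hsu0 hsu
      rw [← hbu] at e3
      have e5 : (1 - s * u) ^ 2 ≤ 1 := pow_le_one₀ (by linarith) (by linarith)
      have e6 : 0 ≤ M - x / 2 * s := le_trans (by positivity) hca
      have e7 : (M - x / 2 * s) * (1 - s * u) ^ 2 ≤ M * 1 :=
        mul_le_mul (sub_le_self _ (by positivity)) e5 (by positivity) (by positivity)
      calc _ ≤ c / 2 * ((s ^ 2) ^ 2 * ((1 - s * u) ^ 2 * (1 + 4 * s ^ 2))) := by gcongr
        _ = s ^ 2 * ((c / 2 * s ^ 2) * ((1 - s * u) ^ 2 * (1 + 4 * s ^ 2))) := by ring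
        _ ≤ s ^ 2 * ((M - x / 2 * s) * ((1 - s * u) ^ 2 * (1 + 4 * s ^ 2))) := by gcongr
        _ = s ^ 2 * ((M - x / 2 * s) * (1 - s * u) ^ 2 +
              4 * (s ^ 2 * ((M - x / 2 * s) * (1 - s * u) ^ 2))) := by ring
        _ ≤ s ^ 2 * ((M - x / 2 * s) * (1 - s * u) ^ 2 + 4 * (s ^ 2 * (M * 1))) := by gcongr
        _ = _ := by ring
    have hlow := le_overlapRate_of_large_overlap ha (by linarith) hsu0 hsu
    rw [← hbu] at hlow
    refine hup.trans (le_trans ?_ hlow)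
    refine mul_le_mul_of_nonneg_left ?_ (by positivity)
    have h9 := mul_le_mul_of_nonneg_left hnear hs.le
    have h10 : s ^ 2 ≤ s ^ 2 * M := le_mul_of_one_le_right (by positivity) (by linarith)
    have hulog : (s * u) * Real.log (s * u) = s * (u * ((1 - M) / 2) + u * Real.log u) := by
      rcases hu.eq_or_lt with rfl | hu
      · simp
      rw [Real.log_mul hs.ne' hu.ne', show Real.log s = (1 - M) / 2 by linarith]
      ring
    rw [hulog, Real.log_pow, show Real.log s = (1 - M) / 2 by linarith]
    push_cast
    linarith

/-- The overlap inequality: for small densities `a` and average degree up to `cLower x a` with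
`x > 4 / e`, no overlap dominates the second moment. -/
lemma exists_le_overlapRate {x : ℝ} (hx : 4 / Real.exp 1 < x) :
    ∃ a₀ : ℝ, 0 < a₀ ∧ a₀ ≤ 1 / 4 ∧ ∀ a, 0 < a → a < a₀ → 0 < cLower x a ∧
      ∀ b c, 0 ≤ b → b ≤ a → 0 ≤ c → c ≤ cLower x a →
        c / 2 * ((b - a ^ 2) ^ 2 / (1 - a) ^ 4) ≤ overlapRate a b := by
  have hx0 : 0 < x := lt_of_le_of_lt (by positivity) hx
  have hd : 0 < x / 2 - 2 / Real.exp 1 := by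
    have : 4 / Real.exp 1 = 2 * (2 / Real.exp 1) := by ring
    linarith
  have t0 : Tendsto (fun a : ℝ ↦ a) (𝓝[>] 0) (𝓝 0) := nhdsWithin_le_nhds
  have tl : Tendsto (fun a : ℝ ↦ Real.log (1 / a) + 1) (𝓝[>] 0) atTop := by
    apply tendsto_atTop_add_const_right
    simp only [one_div]
    exact Real.tendsto_log_atTop.comp tendsto_inv_nhdsGT_zero
  have ts : Tendsto (fun a : ℝ ↦ √a) (𝓝[>] 0) (𝓝 0) := by
    have := (Real.continuous_sqrt.tendsto 0).mono_left (nhdsWithin_le_nhds (s := Set.Ioi 0))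
    simpa using this
  have tm : ∀ r : ℝ, 0 < r →
      Tendsto (fun a : ℝ ↦ a ^ r * (Real.log (1 / a) + 1)) (𝓝[>] 0) (𝓝 0) := by
    intro r hr
    have h1 := (tendsto_log_mul_rpow_nhdsGT_zero hr).neg
    have h2 : Tendsto (fun a : ℝ ↦ a ^ r) (𝓝[>] 0) (𝓝 0) := by
      have := ((Real.continuous_rpow_const hr.le).tendsto 0).mono_left
        (nhdsWithin_le_nhds (s := Set.Ioi 0))
      simpa [Real.zero_rpow hr.ne'] using this
    have h3 := h1.add h2
    simp only [neg_zero, add_zero] at h3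
    refine h3.congr fun a ↦ ?_
    rw [one_div, Real.log_inv]
    ring
  have tm1 := tm 1 one_pos
  have tm2 := tm (1 / 2) (by norm_num)
  simp only [Real.rpow_one, ← Real.sqrt_eq_rpow] at tm1 tm2
  have tsm : Tendsto (fun a : ℝ ↦ 14 * (√a * (Real.log (1 / a) + 1)) + 3 * x * √a)
      (𝓝[>] 0) (𝓝 0) := by
    have := (tm2.const_mul 14).add (ts.const_mul (3 * x))
    simpa using this
  have txs : Tendsto (fun a : ℝ ↦ x * √a) (𝓝[>] 0) (𝓝 0) := by
    simpa using ts.const_mul x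
  have ev : ∀ᶠ a : ℝ in 𝓝[>] 0, a ≤ 1 / 20 ∧ 20 ≤ Real.log (1 / a) + 1 ∧
      a * (Real.log (1 / a) + 1) ≤ 1 / 20 ∧
      14 * (√a * (Real.log (1 / a) + 1)) + 3 * x * √a ≤ x / 2 - 2 / Real.exp 1 ∧
      x * √a ≤ 1 := by
    filter_upwards [t0.eventually_le_const (by norm_num : (0 : ℝ) < 1 / 20),
      tl.eventually_ge_atTop 20, tm1.eventually_le_const (by norm_num : (0 : ℝ) < 1 / 20),
      tsm.eventually_le_const hd, txs.eventually_le_const one_pos] with a h1 h2 h3 h4 h5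
    exact ⟨h1, h2, h3, h4, h5⟩
  obtain ⟨a₀, ha₀, h⟩ := mem_nhdsGT_iff_exists_Ioo_subset.1 ev
  refine ⟨min a₀ (1 / 4), lt_min ha₀ (by norm_num), min_le_right _ _, fun a ha ha' ↦ ?_⟩
  obtain ⟨h1, h2, h3, h4, h5⟩ := h ⟨ha, ha'.trans_le (min_le_left _ _)⟩
  refine ⟨?_, fun b c hb hba hc hcx ↦
    le_overlapRate_of_small hx0 ha h1 rfl h2 h3 h4 hb hba hc hcx⟩
  have hs : 0 < √a := Real.sqrt_pos.2 ha
  have e : cLower x a = (2 * (Real.log (1 / a) + 1) - x * √a) / a := by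
    have : x / √a = x * √a / a := by
      rw [div_eq_div_iff hs.ne' ha.ne', mul_assoc, Real.mul_self_sqrt ha.le]
    rw [cLower, this]
    ring
  rw [e]
  exact div_pos (by linarith) ha

/-! ### Entropy bounds for binomial coefficients and overlaps -/

section Binomial

/-- A single term of the binomial expansion of `(i + (m - i)) ^ m` is at most the sum. -/
lemma choose_mul_pow_le {m i : ℕ} (hi : i ≤ m) :
    (m.choose i : ℝ) * (i ^ i * ((m - i : ℕ) : ℝ) ^ (m - i)) ≤ m ^ m := by
  have h := add_pow (i : ℝ) ((m - i : ℕ) : ℝ) m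
  rw [← Nat.cast_add, Nat.add_sub_cancel' hi] at h
  rw [h]
  refine le_trans (le_of_eq ?_) (Finset.single_le_sum
    (f := fun l ↦ (i : ℝ) ^ l * ((m - i : ℕ) : ℝ) ^ (m - l) * (m.choose l : ℝ))
    (fun l _ ↦ by positivity) (Finset.mem_range.2 (Nat.lt_succ_of_le hi)))
  ring

/-- The term with index `k` is the largest in the binomial expansion of `(k + (n - k)) ^ n`. -/
lemma binomial_term_le {n k : ℕ} (hk : k ≤ n) (i : ℕ) (hi : i ≤ n) :
    n.choose i * (k ^ i * (n - k) ^ (n - i)) ≤ n.choose k * (k ^ k * (n - k) ^ (n - k)) := by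
  set t : ℕ → ℕ := fun i ↦ n.choose i * (k ^ i * (n - k) ^ (n - i)) with ht
  have ratio : ∀ i < n, t (i + 1) * ((i + 1) * (n - k)) = t i * ((n - i) * k) := by
    intro i hi
    have h := Nat.choose_succ_right_eq n i
    obtain ⟨d, rfl⟩ : ∃ d, n = i + 1 + d := ⟨n - (i + 1), by omega⟩
    simp only [ht]
    rw [show i + 1 + d - (i + 1) = d by omega, show i + 1 + d - i = d + 1 by omega] at *
    calc _ = ((i + 1 + d).choose (i + 1) * (i + 1)) *
          (k ^ (i + 1) * (i + 1 + d - k) ^ d * (i + 1 + d - k)) := by ring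
      _ = _ := by rw [h]; ring
  rcases hk.eq_or_lt with rfl | hkn
  · rcases hi.eq_or_lt with rfl | hi
    · exact le_rfl
    · simp [zero_pow (Nat.sub_ne_zero_of_lt hi)]
  rcases Nat.eq_zero_or_pos k with rfl | hk0
  · rcases Nat.eq_zero_or_pos i with rfl | hi
    · exact le_rfl
    · simp [zero_pow hi.ne']
  have up : ∀ i < k, t i ≤ t (i + 1) := by
    intro i hik
    have hr := ratio i (by omega)
    have : (i + 1) * (n - k) ≤ (n - i) * k := by
      obtain ⟨d, rfl⟩ : ∃ d, n = k + d := ⟨n - k, by omega⟩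
      rw [show k + d - k = d by omega]
      calc (i + 1) * d ≤ k * d := Nat.mul_le_mul_right _ hik
        _ = d * k := mul_comm _ _
        _ ≤ _ := Nat.mul_le_mul_right _ (by omega)
    have hpos : 0 < (i + 1) * (n - k) := Nat.mul_pos (by omega) (by omega)
    refine Nat.le_of_mul_le_mul_right ?_ hpos
    rw [hr]
    exact Nat.mul_le_mul_left _ this
  have down : ∀ i, k ≤ i → i < n → t (i + 1) ≤ t i := by
    intro i hi hin
    have hr := ratio i hin
    have : (n - i) * k ≤ (i + 1) * (n - k) := by
      calc (n - i) * k ≤ (n - k) * i := Nat.mul_le_mul (by omega) hi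
        _ = i * (n - k) := mul_comm _ _
        _ ≤ _ := Nat.mul_le_mul_right _ (by omega)
    have hpos : 0 < (i + 1) * (n - k) := Nat.mul_pos (by omega) (by omega)
    refine Nat.le_of_mul_le_mul_right ?_ hpos
    rw [hr]
    exact Nat.mul_le_mul_left _ this
  change t i ≤ t k
  rcases le_total i k with h | h
  · exact Nat.decreasingInduction' (P := fun i ↦ t i ≤ t k)
      (fun j hj _ ih ↦ (up j hj).trans ih) h le_rfl
  · induction i, h using Nat.le_induction with
    | base => exact le_rfl
    | succ i hki ih => exact (down i hki hi).trans (ih (by omega))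

lemma pow_le_choose_mul {n k : ℕ} (hk : k ≤ n) :
    (n : ℝ) ^ n ≤ (n + 1) * ((n.choose k : ℝ) * (k ^ k * ((n - k : ℕ) : ℝ) ^ (n - k))) := by
  have h := add_pow k (n - k) n
  rw [Nat.add_sub_cancel' hk] at h
  have h2 : n ^ n ≤ (n + 1) * (n.choose k * (k ^ k * (n - k) ^ (n - k))) := by
    rw [h]
    calc _ ≤ ∑ _i ∈ Finset.range (n + 1), n.choose k * (k ^ k * (n - k) ^ (n - k)) := by
          refine Finset.sum_le_sum fun i hi ↦ ?_
          refine le_trans (le_of_eq ?_)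
            (binomial_term_le hk i (Nat.lt_succ_iff.1 (Finset.mem_range.1 hi)))
          simp only [Nat.cast_id]
          ring
      _ = _ := by simp
  exact_mod_cast h2

lemma natCast_pow_self_eq_exp (m : ℕ) : (m : ℝ) ^ m = Real.exp (m * Real.log m) := by
  rcases Nat.eq_zero_or_pos m with rfl | hm
  · simp
  · rw [mul_comm, Real.exp_mul, Real.exp_log (by positivity), Real.rpow_natCast]

lemma choose_le_exp {m i : ℕ} (hi : i ≤ m) :
    (m.choose i : ℝ) ≤ Real.exp (m * Real.log m - i * Real.log i -
      ((m - i : ℕ) : ℝ) * Real.log ((m - i : ℕ) : ℝ)) := by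
  have h := choose_mul_pow_le hi
  simp only [natCast_pow_self_eq_exp, ← Real.exp_add] at h
  rw [sub_sub, Real.exp_sub, le_div_iff₀ (Real.exp_pos _)]
  exact h

lemma exp_le_choose {n k : ℕ} (hk : k ≤ n) :
    Real.exp (n * Real.log n - k * Real.log k - ((n - k : ℕ) : ℝ) * Real.log ((n - k : ℕ) : ℝ)) ≤
      (n + 1) * (n.choose k : ℝ) := by
  have h := pow_le_choose_mul hk
  simp only [natCast_pow_self_eq_exp, ← Real.exp_add] at h
  rw [sub_sub, Real.exp_sub, div_le_iff₀ (Real.exp_pos _)]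
  linarith

/-- Large deviation bound for the hypergeometric distribution of the overlap of two `k`-sets. -/
lemma choose_mul_choose_le {n k j : ℕ} (hk0 : 0 < k) (hk : 2 * k ≤ n) (hj : j ≤ k) :
    ((k.choose j : ℝ) * ((n - k).choose (k - j) : ℝ)) ≤
      (n + 1) * (n.choose k : ℝ) * Real.exp (-(n * overlapRate (k / n) (j / n))) := by
  have hn : (0 : ℝ) < n := by
    have : 0 < n := by omega
    exact_mod_cast this
  have h1 := choose_le_exp hj
  have h2 := choose_le_exp (m := n - k) (i := k - j) (by omega)
  have h3 := exp_le_choose (n := n) (k := k) (by omega)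
  have e0 : n - k - (k - j) = n - 2 * k + j := by omega
  rw [e0] at h2
  have c1 : ((k - j : ℕ) : ℝ) = k - j := Nat.cast_sub hj
  have c2 : ((n - k : ℕ) : ℝ) = n - k := Nat.cast_sub (by omega)
  have c3 : ((n - 2 * k + j : ℕ) : ℝ) = n - 2 * k + j := by
    rw [Nat.cast_add, Nat.cast_sub hk]
    push_cast
    ring
  rw [c1] at h1 h2
  rw [c2] at h2 h3
  rw [c3] at h2
  have scale : ∀ y : ℝ, n * (y / n * Real.log (y / n)) = y * Real.log y - y * Real.log n := by
    intro y
    rcases eq_or_ne y 0 with rfl | hy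
    · simp
    rw [Real.log_div hy hn.ne']
    field_simp
  have eR : n * overlapRate (k / n) (j / n) = j * Real.log j + 2 * ((k - j) * Real.log (k - j)) +
      (n - 2 * k + j) * Real.log (n - 2 * k + j) - 2 * (k * Real.log k) -
      2 * ((n - k) * Real.log (n - k)) + n * Real.log n := by
    have d1 : (k : ℝ) / n - j / n = (k - j) / n := by ring
    have d2 : 1 - 2 * ((k : ℝ) / n) + j / n = (n - 2 * k + j) / n := by field_simp
    have d3 : 1 - (k : ℝ) / n = (n - k) / n := by field_simp
    rw [overlapRate, d1, d2, d3]
    have s1 := scale j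
    have s2 := scale (k - j)
    have s3 := scale (n - 2 * k + j)
    have s4 := scale k
    have s5 := scale (n - k)
    linear_combination s1 + 2 * s2 + s3 - 2 * s4 - 2 * s5
  rw [eR]
  calc _ ≤ _ := mul_le_mul h1 h2 (by positivity) (Real.exp_nonneg _)
    _ = Real.exp (n * Real.log n - k * Real.log k - (n - k) * Real.log (n - k)) *
          Real.exp (-(j * Real.log j + 2 * ((k - j) * Real.log (k - j)) +
            (n - 2 * k + j) * Real.log (n - 2 * k + j) - 2 * (k * Real.log k) -
            2 * ((n - k) * Real.log (n - k)) + n * Real.log n)) := by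
        rw [← Real.exp_add, ← Real.exp_add]
        congr 1
        ring
    _ ≤ _ := mul_le_mul_of_nonneg_right h3 (Real.exp_nonneg _)

end Binomial

open Finset in
lemma card_filter_card_inter {n k j : ℕ} (S : Finset (Fin n)) (hS : #S = k) (hj : j ≤ k) :
    #{T ∈ powersetCard k (univ : Finset (Fin n)) | #(S ∩ T) = j} =
      k.choose j * (n - k).choose (k - j) := by
  have e : #(powersetCard j S ×ˢ powersetCard (k - j) Sᶜ) =
      k.choose j * (n - k).choose (k - j) := by
    rw [card_product, card_powersetCard, card_powersetCard, card_compl, Fintype.card_fin, hS]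
  rw [← e]
  refine card_nbij' (fun T ↦ (S ∩ T, T \ S)) (fun q ↦ q.1 ∪ q.2) ?_ ?_ ?_ ?_
  · intro T hT
    simp only [coe_filter, mem_powersetCard, Set.mem_ofPred_eq] at hT
    simp only [coe_product, Set.mem_prod, mem_coe, mem_powersetCard, inter_subset_left, hT.2,
      true_and, and_true]
    refine ⟨fun v hv ↦ by simp_all, ?_⟩
    have := card_sdiff_add_card_inter T S
    rw [inter_comm, hT.2] at this
    omega
  · rintro ⟨A, B⟩ hq
    simp only [coe_product, Set.mem_prod, mem_coe, mem_powersetCard] at hq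
    obtain ⟨⟨hA, hA'⟩, hB, hB'⟩ := hq
    have hd : Disjoint S B := by
      rw [← subset_compl_iff_disjoint_left]
      exact hB
    have hi : S ∩ (A ∪ B) = A := by
      rw [inter_union_distrib_left, inter_eq_right.2 hA, disjoint_iff_inter_eq_empty.1 hd,
        union_empty]
    simp only [coe_filter, mem_powersetCard, Set.mem_ofPred_eq, hi, hA', subset_univ, true_and,
      and_true]
    rw [card_union_of_disjoint (hd.mono_left hA), hA', hB']
    omega
  · intro T _
    ext v
    simp only [mem_union, mem_inter, Finset.mem_sdiff]
    tauto
  · rintro ⟨A, B⟩ hq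
    simp only [coe_product, Set.mem_prod, mem_coe, mem_powersetCard] at hq
    obtain ⟨⟨hA, _⟩, hB, _⟩ := hq
    ext v
    · have := @hA v
      have := @hB v
      simp_all only [mem_inter, mem_union, mem_compl]
      tauto
    · have := @hA v
      have := @hB v
      simp_all only [Finset.mem_sdiff, mem_union, mem_compl]
      tauto

open Finset in
/-- If no overlap `j` beats the entropy, the pairs of `k`-sets weighted by `exp (n φ)` number at
most polynomially more than all pairs. -/
lemma sum_pairs_le {n k : ℕ} (hk0 : 0 < k) (hk : 2 * k ≤ n) (φ : ℕ → ℝ)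
    (hφ : ∀ j ≤ k, φ j ≤ overlapRate (k / n) (j / n)) :
    ∑ S ∈ powersetCard k (univ : Finset (Fin n)), ∑ T ∈ powersetCard k (univ : Finset (Fin n)),
      Real.exp (n * φ #(S ∩ T)) ≤ (n + 1) ^ 2 * (n.choose k : ℝ) ^ 2 := by
  have inner : ∀ S ∈ powersetCard k (univ : Finset (Fin n)),
      ∑ T ∈ powersetCard k (univ : Finset (Fin n)), Real.exp (n * φ #(S ∩ T)) ≤
        (n + 1) ^ 2 * (n.choose k : ℝ) := by
    intro S hS
    have hS := (mem_powersetCard.1 hS).2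
    rw [← sum_fiberwise_of_maps_to (t := range (k + 1)) (g := fun T ↦ #(S ∩ T))
      (fun T _ ↦ mem_range.2 (Nat.lt_succ_of_le (hS ▸ card_le_card inter_subset_left)))]
    calc _ ≤ ∑ _j ∈ range (k + 1), (n + 1) * (n.choose k : ℝ) := by
          refine sum_le_sum fun j hj ↦ ?_
          have hj := Nat.lt_succ_iff.1 (mem_range.1 hj)
          rw [sum_congr rfl fun T hT ↦ by rw [(mem_filter.1 hT).2], sum_const,
            card_filter_card_inter S hS hj, nsmul_eq_mul]
          push_cast
          have h1 := choose_mul_choose_le hk0 hk hj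
          have h2 : Real.exp (n * φ j) ≤ Real.exp (n * overlapRate (k / n) (j / n)) := by
            have := hφ j hj
            gcongr
          calc _ ≤ _ := mul_le_mul h1 h2 (Real.exp_nonneg _) (by positivity)
            _ = _ := by rw [mul_assoc, ← Real.exp_add]; simp
      _ ≤ _ := by
          rw [sum_const, card_range, nsmul_eq_mul]
          have : (k : ℝ) ≤ n := by
            have : k ≤ n := by omega
            exact_mod_cast this
          push_cast
          have h0 : 0 ≤ ((n : ℝ) + 1) * (n.choose k : ℝ) := by positivity
          nlinarith
  calc _ ≤ _ := sum_le_sum inner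
    _ = _ := by
      rw [sum_const, card_powersetCard, card_univ, Fintype.card_fin, nsmul_eq_mul]
      ring

/-! ### Edge weights -/

section Edges

open Finset

/-- The edges of the complete graph on `V`. -/
abbrev Edge (V : Type*) : Type _ := {e : Sym2 V // ¬ e.IsDiag}

/-- The graph with edge set `A`. -/
def edgeGraph {V : Type*} (A : Finset (Edge V)) : SimpleGraph V :=
  SimpleGraph.fromEdgeSet {e | ∃ h : ¬ e.IsDiag, ⟨e, h⟩ ∈ A}

lemma edgeGraph_adj {V : Type*} {A : Finset (Edge V)} {u v : V} :
    (edgeGraph A).Adj u v ↔ ∃ h : ¬ s(u, v).IsDiag, ⟨s(u, v), h⟩ ∈ A := by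
  rw [edgeGraph, SimpleGraph.fromEdgeSet_adj]
  exact ⟨fun h ↦ h.1, fun h ↦ ⟨h, fun huv ↦ h.1 (Sym2.mk_isDiag_iff.2 huv)⟩⟩

lemma two_mul_sum_edge {n : ℕ} (F : Sym2 (Fin n) → ℝ) :
    2 * ∑ e : Edge (Fin n), F e = ∑ u, ∑ v, F s(u, v) - ∑ u, F s(u, u) := by
  have h1 : ∑ e : Edge (Fin n), F e = ∑ ij ∈ (univ : Finset (Fin n)).offDiag with ij.1 < ij.2,
      F s(ij.1, ij.2) := by
    rw [← sum_sym2_filter_not_isDiag, sym2_univ]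
    exact (sum_subtype _ (by simp) F).symm
  have h2 : ∑ ij ∈ (univ : Finset (Fin n)).offDiag with ¬ ij.1 < ij.2, F s(ij.1, ij.2) =
      ∑ ij ∈ (univ : Finset (Fin n)).offDiag with ij.1 < ij.2, F s(ij.1, ij.2) := by
    refine sum_nbij' Prod.swap Prod.swap ?_ ?_ (fun _ _ ↦ rfl) (fun _ _ ↦ rfl) ?_
    · rintro ⟨u, v⟩ h
      simp only [mem_filter, mem_offDiag, Prod.swap] at h ⊢
      exact ⟨by simpa using h.1.2.2.symm, lt_of_le_of_ne (not_lt.1 h.2) h.1.2.2.symm⟩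
    · rintro ⟨u, v⟩ h
      simp only [mem_filter, mem_offDiag, Prod.swap] at h ⊢
      exact ⟨by simpa using h.1.2.2.symm, not_lt.2 h.2.le⟩
    · rintro ⟨u, v⟩ _
      simp [Sym2.eq_swap]
  have h3 := sum_filter_add_sum_filter_not (univ : Finset (Fin n)).offDiag
    (fun ij ↦ ij.1 < ij.2) (fun ij ↦ F s(ij.1, ij.2))
  have h4 : ∑ u, ∑ v, F s(u, v) = ∑ u, F s(u, u) +
      ∑ ij ∈ (univ : Finset (Fin n)).offDiag, F s(ij.1, ij.2) := by
    rw [← sum_product' univ univ (fun u v ↦ F s(u, v)), ← diag_union_offDiag,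
      sum_union (disjoint_diag_offDiag _), sum_diag]
  rw [h4, ← h3, h2, h1]
  ring

lemma card_edge (n : ℕ) : (Fintype.card (Edge (Fin n)) : ℝ) = n * (n - 1) / 2 := by
  have h := two_mul_sum_edge (n := n) (fun _ ↦ 1)
  simp only [sum_const, card_univ, Fintype.card_fin, nsmul_eq_mul, mul_one] at h
  linarith

/-- The product of `h` over the endpoints of an edge. -/
def endMul {V : Type*} (h : V → ℝ) (e : Sym2 V) : ℝ := (e.map h).mul

@[simp] lemma endMul_mk {V : Type*} (h : V → ℝ) (u v : V) : endMul h s(u, v) = h u * h v := rfl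

lemma abs_endMul_le {V : Type*} {h : V → ℝ} (hh : ∀ v, |h v| ≤ 1) (e : Sym2 V) :
    |endMul h e| ≤ 1 := by
  induction e with
  | _ u v =>
    rw [endMul_mk, abs_mul]
    exact mul_le_one₀ (hh u) (abs_nonneg _) (hh v)

lemma exp_le_one_sub {z : ℝ} (hz : |z| ≤ 1 / 2) : Real.exp (-z - 2 * z ^ 2) ≤ 1 - z := by
  have hz' := abs_le.1 hz
  have h1 : 0 < 1 - z := by linarith
  have h2 : (1 - z)⁻¹ ≤ 1 + z + 2 * z ^ 2 := by
    rw [inv_le_iff_one_le_mul₀ h1]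
    nlinarith [mul_nonneg (sq_nonneg z) (by linarith : 0 ≤ 1 - 2 * z)]
  have h3 := Real.one_sub_inv_le_log_of_pos h1
  rw [← Real.le_log_iff_exp_le h1]
  linarith

/-- Lower bound for the expectation of the weight `∏ (1 - h u * h v)` over the edges `uv` of the
random graph, when `h` has mean zero. -/
lemma exp_le_prod_edge {n : ℕ} {c : ℝ} (hc : 0 ≤ c) (hcn : 2 * c ≤ n) {h : Fin n → ℝ}
    (hh : ∀ v, |h v| ≤ 1) (h0 : ∑ v, h v = 0) :
    Real.exp (-c ^ 2) ≤ ∏ e : Edge (Fin n), (c / n * (1 - endMul h e) + (1 - c / n)) := by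
  rcases Nat.eq_zero_or_pos n with rfl | hn
  · obtain rfl : c = 0 := le_antisymm (by push_cast at hcn; linarith) hc
    simp
  have hn' : (0 : ℝ) < n := by exact_mod_cast hn
  set p := c / n with hp
  have hp0 : 0 ≤ p := by positivity
  have hp2 : p ≤ 1 / 2 := by rw [hp, div_le_iff₀ hn']; linarith
  have hpn : p * n = c := by rw [hp]; field_simp
  have hsum : ∑ e : Edge (Fin n), endMul h e ≤ 0 := by
    have h1 := two_mul_sum_edge (endMul h)
    simp only [endMul_mk, ← mul_sum, ← sum_mul, h0] at h1
    have h2 : 0 ≤ ∑ u, h u * h u := sum_nonneg fun u _ ↦ mul_self_nonneg _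
    linarith
  have hsum2 : ∑ e : Edge (Fin n), endMul h e ^ 2 ≤ (n : ℝ) ^ 2 / 2 := by
    calc _ ≤ ∑ _e : Edge (Fin n), (1 : ℝ) := sum_le_sum fun e _ ↦
          (sq_le_one_iff_abs_le_one _).2 (abs_endMul_le hh e)
      _ = n * (n - 1) / 2 := by rw [sum_const, card_univ, nsmul_eq_mul, mul_one, card_edge]
      _ ≤ _ := by nlinarith
  calc Real.exp (-c ^ 2)
      ≤ Real.exp (∑ e : Edge (Fin n), (-(p * endMul h e) - 2 * (p * endMul h e) ^ 2)) := by
        apply Real.exp_le_exp.2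
        simp only [sum_sub_distrib, sum_neg_distrib, mul_pow, ← mul_sum]
        have h1 := mul_le_mul_of_nonneg_left hsum hp0
        have h2 := mul_le_mul_of_nonneg_left hsum2 (sq_nonneg p)
        have h3 : p ^ 2 * ((n : ℝ) ^ 2 / 2) = c ^ 2 / 2 := by rw [← hpn]; ring
        linarith
    _ = ∏ e : Edge (Fin n), Real.exp (-(p * endMul h e) - 2 * (p * endMul h e) ^ 2) :=
        Real.exp_sum _ _
    _ ≤ _ := by
        refine prod_le_prod (fun _ _ ↦ Real.exp_nonneg _) fun e _ ↦ ?_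
        have h1 : |p * endMul h e| ≤ 1 / 2 := by
          rw [abs_mul, abs_of_nonneg hp0]
          have := abs_endMul_le hh e.1
          nlinarith [abs_nonneg (endMul h e.1)]
        exact (exp_le_one_sub h1).trans (le_of_eq (by ring))

/-- Upper bound for the expectation of the product of two edge weights: only the correlation
`∑ g v * h v` enters. -/
lemma prod_edge_le_exp {n : ℕ} {c : ℝ} (hc : 0 ≤ c) (hcn : 2 * c ≤ n) {g h : Fin n → ℝ}
    (hg : ∀ v, |g v| ≤ 1) (hh : ∀ v, |h v| ≤ 1) (g0 : ∑ v, g v = 0) (h0 : ∑ v, h v = 0) :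
    ∏ e : Edge (Fin n), (c / n * ((1 - endMul g e) * (1 - endMul h e)) + (1 - c / n)) ≤
      Real.exp (c / 2 + c / (2 * n) * (∑ v, g v * h v) ^ 2) := by
  rcases Nat.eq_zero_or_pos n with rfl | hn
  · obtain rfl : c = 0 := le_antisymm (by push_cast at hcn; linarith) hc
    simp
  have hn' : (0 : ℝ) < n := by exact_mod_cast hn
  set p := c / n with hp
  have hp0 : 0 ≤ p := by positivity
  have hp2 : p ≤ 1 / 2 := by rw [hp, div_le_iff₀ hn']; linarith
  have hw : ∀ {f : Fin n → ℝ}, (∀ v, |f v| ≤ 1) → ∀ e, 0 ≤ 1 - endMul f e := fun hf e ↦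
    sub_nonneg.2 (abs_le.1 (abs_endMul_le hf e)).2
  have hsum : 2 * ∑ e : Edge (Fin n), ((1 - endMul g e) * (1 - endMul h e) - 1) ≤
      (∑ v, g v * h v) ^ 2 + n := by
    rw [two_mul_sum_edge (fun e ↦ (1 - endMul g e) * (1 - endMul h e) - 1)]
    have h1 : ∑ u, ∑ v, ((1 - endMul g s(u, v)) * (1 - endMul h s(u, v)) - 1) =
        (∑ v, g v * h v) ^ 2 := by
      have : ∀ u v, (1 - endMul g s(u, v)) * (1 - endMul h s(u, v)) - 1 =
          (g u * h u) * (g v * h v) - g u * g v - h u * h v := by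
        intro u v
        simp only [endMul_mk]
        ring
      simp only [this, sum_sub_distrib, ← mul_sum, ← sum_mul, g0, h0]
      ring
    have h2 : -(n : ℝ) ≤ ∑ u, ((1 - endMul g s(u, u)) * (1 - endMul h s(u, u)) - 1) := by
      calc -(n : ℝ) = ∑ _u : Fin n, (-1 : ℝ) := by simp
        _ ≤ _ := sum_le_sum fun u _ ↦ by
          have := mul_nonneg (hw hg s(u, u)) (hw hh s(u, u))
          linarith
    linarith
  calc _ ≤ ∏ e : Edge (Fin n), Real.exp (p * ((1 - endMul g e) * (1 - endMul h e) - 1)) := by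
        refine prod_le_prod (fun e _ ↦ ?_) fun e _ ↦ ?_
        · have := mul_nonneg (hw hg e) (hw hh e)
          have := mul_nonneg hp0 this
          linarith
        · refine le_trans (le_of_eq ?_) (Real.add_one_le_exp _)
          ring
    _ = Real.exp (p * ∑ e : Edge (Fin n), ((1 - endMul g e) * (1 - endMul h e) - 1)) := by
        rw [← Real.exp_sum, mul_sum]
    _ ≤ _ := by
        apply Real.exp_le_exp.2
        have h1 := mul_le_mul_of_nonneg_left hsum hp0
        have h2 : p * ((∑ v, g v * h v) ^ 2 + n) =
            2 * (c / 2 + c / (2 * n) * (∑ v, g v * h v) ^ 2) := by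
          rw [hp]
          field_simp
          ring
        linarith

end Edges

/-! ### The weighted second moment -/

section SecondMoment

open Finset

/-- The indicator of `S`, centred at the density `a` and scaled to be `1` on `S`. -/
noncomputable def centredIndicator {n : ℕ} (a : ℝ) (S : Finset (Fin n)) (v : Fin n) : ℝ :=
  ((if v ∈ S then 1 else 0) - a) / (1 - a)

variable {n k : ℕ} {S T : Finset (Fin n)}

lemma abs_centredIndicator_le {a : ℝ} (ha : 0 ≤ a) (ha1 : a ≤ 1 / 2) (v : Fin n) :
    |centredIndicator a S v| ≤ 1 := by
  have h : 0 < 1 - a := by linarith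
  rw [centredIndicator, abs_div, abs_of_pos h, div_le_one h, abs_le]
  split_ifs <;> constructor <;> linarith

lemma centredIndicator_eq_one {a : ℝ} (ha1 : a ≤ 1 / 2) {v : Fin n} (hv : v ∈ S) :
    centredIndicator a S v = 1 := by
  have h : 1 - a ≠ 0 := by linarith
  rw [centredIndicator, if_pos hv, div_self h]

lemma sum_centredIndicator (hn : 0 < n) (hS : #S = k) :
    ∑ v, centredIndicator (k / n) S v = 0 := by
  have hn' : (n : ℝ) ≠ 0 := by exact_mod_cast hn.ne'
  simp only [centredIndicator, ← sum_div, sum_sub_distrib, sum_boole, filter_mem_eq_inter,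
    univ_inter, hS, sum_const, card_univ, Fintype.card_fin, nsmul_eq_mul]
  field_simp
  simp

lemma sum_centredIndicator_mul (hn : 0 < n) (hS : #S = k) (hT : #T = k) :
    ∑ v, centredIndicator (k / n) S v * centredIndicator (k / n) T v =
      n * ((#(S ∩ T) / n - (k / n) ^ 2) / (1 - k / n) ^ 2) := by
  have hn' : (n : ℝ) ≠ 0 := by exact_mod_cast hn.ne'
  set a : ℝ := k / n with ha
  have hk : (k : ℝ) = n * a := by rw [ha]; field_simp
  have h1 : ∀ v, centredIndicator a S v * centredIndicator a T v =
      ((if v ∈ S ∩ T then 1 else 0) - a * (if v ∈ S then 1 else 0) - a * (if v ∈ T then 1 else 0)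
        + a ^ 2) / (1 - a) ^ 2 := by
    intro v
    simp only [centredIndicator, mem_inter]
    rw [div_mul_div_comm, ← sq]
    congr 1
    by_cases h1 : v ∈ S <;> by_cases h2 : v ∈ T <;> simp [h1, h2] <;> ring
  simp only [h1, ← sum_div, sum_add_distrib, sum_sub_distrib, ← mul_sum, sum_boole,
    filter_mem_eq_inter, univ_inter, hS, hT, sum_const, card_univ, Fintype.card_fin, nsmul_eq_mul]
  rw [← mul_div_assoc, hk]
  congr 1
  field_simp
  ring

/-- The weighted second moment method. A `k`-set `S` of density `a = k / n` is
weighted by `∏ (1 - h u * h v)` over the edges `uv`, where `h` is the centred indicator of `S`; the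
weight vanishes as soon as an edge lies in `S`. -/
lemma le_bernProb_indepSet {c : ℝ} (hk0 : 0 < k) (hk : 2 * k ≤ n) (hc : 0 ≤ c) (hcn : 2 * c ≤ n)
    (hφ : ∀ j ≤ k, c / 2 * (((j : ℝ) / n - (k / n) ^ 2) ^ 2 / (1 - k / n) ^ 4) ≤
      overlapRate (k / n) (j / n)) :
    Real.exp (-(2 * c ^ 2 + c / 2)) / (n + 1) ^ 2 ≤
      bernProb (c / n) univ
        (fun A : Finset (Edge (Fin n)) ↦ ∃ S, (edgeGraph A).IsNIndepSet k S) := by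
  classical
  have hn : 0 < n := by omega
  have hn' : (0 : ℝ) < n := by exact_mod_cast hn
  have hp0 : 0 ≤ c / n := by positivity
  have hp1 : c / n ≤ 1 := by rw [div_le_one hn']; linarith
  set a : ℝ := k / n with ha
  have ha0 : 0 ≤ a := by positivity
  have ha1 : a ≤ 1 / 2 := by
    rw [ha, div_le_div_iff₀ hn' two_pos, one_mul, mul_comm]
    exact_mod_cast hk
  set P := powersetCard k (univ : Finset (Fin n)) with hP
  set w : Finset (Fin n) → Edge (Fin n) → ℝ := fun S e ↦ 1 - endMul (centredIndicator a S) e with hw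
  set X : Finset (Edge (Fin n)) → ℝ := fun A ↦ ∑ S ∈ P, ∏ e ∈ A, w S e with hX
  set Q : Finset (Edge (Fin n)) → Prop := fun A ↦ ∃ S, (edgeGraph A).IsNIndepSet k S with hQ
  have hcard : (#P : ℝ) = n.choose k := by
    rw [hP, card_powersetCard, card_univ, Fintype.card_fin]
  have hPcard : ∀ {S}, S ∈ P → #S = k := fun h ↦ (mem_powersetCard.1 h).2
  have hCpos : (0 : ℝ) < n.choose k := by exact_mod_cast Nat.choose_pos (by omega)
  -- first moment
  have first : (n.choose k : ℝ) * Real.exp (-c ^ 2) ≤ bernExp (c / n) univ X := by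
    rw [hX, bernExp_sum, ← hcard, ← nsmul_eq_mul, ← sum_const]
    refine sum_le_sum fun S hS ↦ ?_
    rw [bernExp_prod]
    exact exp_le_prod_edge hc hcn (abs_centredIndicator_le ha0 ha1)
      (sum_centredIndicator hn (hPcard hS))
  -- second moment
  have second : bernExp (c / n) univ (fun A ↦ X A ^ 2) ≤
      Real.exp (c / 2) * ((n + 1) ^ 2 * (n.choose k : ℝ) ^ 2) := by
    have e1 : ∀ A, X A ^ 2 = ∑ S ∈ P, ∑ T ∈ P, ∏ e ∈ A, (w S e * w T e) := by
      intro A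
      simp only [hX, sq, sum_mul_sum, prod_mul_distrib]
    simp only [e1, bernExp_sum, bernExp_prod]
    refine le_trans ?_ (mul_le_mul_of_nonneg_left (sum_pairs_le hk0 hk _ hφ) (Real.exp_nonneg _))
    rw [mul_sum]
    refine sum_le_sum fun S hS ↦ ?_
    rw [mul_sum]
    refine sum_le_sum fun T hT ↦ ?_
    refine (prod_edge_le_exp hc hcn (abs_centredIndicator_le ha0 ha1)
      (abs_centredIndicator_le ha0 ha1) (sum_centredIndicator hn (hPcard hS))
      (sum_centredIndicator hn (hPcard hT))).trans (le_of_eq ?_)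
    rw [sum_centredIndicator_mul hn (hPcard hS) (hPcard hT), ← Real.exp_add]
    congr 1
    rw [← ha]
    have : 1 - a ≠ 0 := by linarith
    field_simp
  -- the weight vanishes unless some `k`-set is independent
  have supp : ∀ A, X A * (if Q A then 1 else 0) = X A := by
    intro A
    split_ifs with h
    · rw [mul_one]
    · rw [mul_zero, eq_comm]
      refine sum_eq_zero fun S hS ↦ ?_
      have hS' : ¬ (edgeGraph A).IsIndepSet S := fun hi ↦ h ⟨S, hi, hPcard hS⟩
      rw [SimpleGraph.IsIndepSet, Set.Pairwise] at hS'
      push Not at hS'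
      obtain ⟨u, hu, v, hv, -, hadj⟩ := hS'
      obtain ⟨hd, hmem⟩ := edgeGraph_adj.1 hadj
      refine prod_eq_zero hmem ?_
      simp only [hw, endMul_mk]
      rw [centredIndicator_eq_one ha1 hu, centredIndicator_eq_one ha1 hv]
      norm_num
  have cs := bernExp_mul_sq_le (s := univ) (f := X)
    (g := fun A ↦ if Q A then (1 : ℝ) else 0) hp0 hp1
  simp only [supp] at cs
  have e2 : bernExp (c / n) univ (fun A ↦ (if Q A then (1 : ℝ) else 0) ^ 2) =
      bernProb (c / n) univ Q := by
    rw [bernProb]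
    congr 1
    ext A
    split_ifs <;> simp
  rw [e2] at cs
  have hpr : 0 ≤ bernProb (c / n) univ Q := by
    rw [← bernExp_const (p := c / n) (s := univ) (E := Edge (Fin n)) 0]
    exact bernExp_mono hp0 hp1 fun A _ ↦ by split_ifs <;> simp
  have h1 : ((n.choose k : ℝ) * Real.exp (-c ^ 2)) ^ 2 ≤
      Real.exp (c / 2) * ((n + 1) ^ 2 * (n.choose k : ℝ) ^ 2) * bernProb (c / n) univ Q :=
    (pow_le_pow_left₀ (by positivity) first 2).trans
      (cs.trans (mul_le_mul_of_nonneg_right second hpr))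
  rw [div_le_iff₀ (by positivity)]
  have e3 : Real.exp (-(2 * c ^ 2 + c / 2)) * Real.exp (c / 2) = Real.exp (-c ^ 2) ^ 2 := by
    rw [← Real.exp_add, ← Real.exp_nat_mul]
    congr 1
    push_cast
    ring
  refine le_of_mul_le_mul_right ?_ (by positivity : 0 < Real.exp (c / 2) * (n.choose k : ℝ) ^ 2)
  calc _ = ((n.choose k : ℝ) * Real.exp (-c ^ 2)) ^ 2 := by rw [← mul_assoc, e3]; ring
    _ ≤ _ := h1
    _ = _ := by ring

end SecondMoment

/-! ### The independence number -/

section IndepNum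

open Finset

lemma edgeGraph_mono {V : Type*} {A B : Finset (Edge V)} (h : A ⊆ B) : edgeGraph A ≤ edgeGraph B := by
  intro u v huv
  obtain ⟨hd, hm⟩ := edgeGraph_adj.1 huv
  exact edgeGraph_adj.2 ⟨hd, h hm⟩

variable {V : Type*} [Fintype V]

lemma exists_isNIndepSet_iff {G : SimpleGraph V} {k : ℕ} :
    (∃ S, G.IsNIndepSet k S) ↔ k ≤ G.indepNum := by
  constructor
  · rintro ⟨S, hS⟩
    rw [← hS.2]
    exact hS.1.card_le_indepNum
  · intro h
    obtain ⟨S, hS⟩ := G.exists_isNIndepSet_indepNum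
    rw [← hS.2] at h
    obtain ⟨T, hTS, hT⟩ := exists_subset_card_eq h
    exact ⟨T, hS.1.mono (by exact_mod_cast hTS), hT⟩

lemma indepNum_anti {G H : SimpleGraph V} (h : G ≤ H) : H.indepNum ≤ G.indepNum := by
  obtain ⟨S, hS⟩ := H.exists_isNIndepSet_indepNum
  exact exists_isNIndepSet_iff.1 ⟨S, fun u hu v hv huv hadj ↦ hS.1 hu hv huv (h hadj), hS.2⟩

variable [DecidableEq V]

/-- Adding an edge lowers the independence number by at most one: delete an endpoint. -/
lemma indepNum_le_insert (A : Finset (Edge V)) (e : Edge V) :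
    (edgeGraph A).indepNum ≤ (edgeGraph (insert e A)).indepNum + 1 := by
  obtain ⟨S, hS⟩ := (edgeGraph A).exists_isNIndepSet_indepNum
  obtain ⟨⟨u, w⟩, he⟩ := e
  have hT : (edgeGraph (insert ⟨s(u, w), he⟩ A)).IsIndepSet (S.erase u : Finset V) := by
    intro x hx y hy hxy hadj
    simp only [coe_erase, Set.mem_sdiff, mem_coe, Set.mem_singleton_iff] at hx hy
    obtain ⟨hd, hm⟩ := edgeGraph_adj.1 hadj
    rcases mem_insert.1 hm with h | h
    · rcases Sym2.eq_iff.1 (congrArg Subtype.val h) with h | h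
      · exact hx.2 h.1
      · exact hy.2 h.2
    · exact hS.1 hx.1 hy.1 hxy (edgeGraph_adj.2 ⟨hd, h⟩)
  have h1 := hT.card_le_indepNum
  have h2 := pred_card_le_card_erase (s := S) (a := u)
  have h3 := hS.2
  have h4 := h2.trans h1
  rw [h3] at h4
  exact Nat.sub_le_iff_le_add.1 h4

lemma abs_indepNum_insert_sub_le (A : Finset (Edge V)) (e : Edge V) :
    |((edgeGraph (insert e A)).indepNum : ℝ) - (edgeGraph A).indepNum| ≤ 1 := by
  have h1 : ((edgeGraph (insert e A)).indepNum : ℝ) ≤ (edgeGraph A).indepNum := by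
    exact_mod_cast indepNum_anti (edgeGraph_mono (subset_insert e A))
  have h2 : ((edgeGraph A).indepNum : ℝ) ≤ (edgeGraph (insert e A)).indepNum + 1 := by
    exact_mod_cast indepNum_le_insert A e
  rw [abs_le]
  constructor <;> linarith

end IndepNum

/-! ### Random graphs as random edge sets -/

section Transfer

open Finset

variable {n : ℕ}

lemma edgeSet_edgeGraph {V : Type*} (A : Finset (Edge V)) :
    (edgeGraph A).edgeSet = Subtype.val '' (A : Set (Edge V)) := by
  ext e
  induction e with
  | _ u v =>
    rw [SimpleGraph.mem_edgeSet, edgeGraph_adj]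
    simp

lemma ncard_edgeSet_edgeGraph {V : Type*} (A : Finset (Edge V)) :
    (edgeGraph A).edgeSet.ncard = #A := by
  rw [edgeSet_edgeGraph, Set.ncard_image_of_injective _ Subtype.val_injective,
    Set.ncard_coe_finset]

lemma edgeGraph_bijective : Function.Bijective (edgeGraph (V := Fin n)) := by
  classical
  constructor
  · intro A B h
    have := congrArg SimpleGraph.edgeSet h
    rw [edgeSet_edgeGraph, edgeSet_edgeGraph] at this
    exact_mod_cast Subtype.val_injective.image_injective this
  · intro G
    refine ⟨univ.filter fun e ↦ (e : Sym2 (Fin n)) ∈ G.edgeSet, ?_⟩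
    ext u v
    rw [edgeGraph_adj]
    simp only [mem_filter, mem_univ, true_and, SimpleGraph.mem_edgeSet, Sym2.mk_isDiag_iff,
      exists_prop]
    exact ⟨fun h ↦ h.2, fun h ↦ ⟨h.ne, h⟩⟩

instance : MeasurableSingletonClass (SimpleGraph (Fin n)) where
  measurableSet_singleton G := by
    have h := SimpleGraph.measurableEmbedding_edgeSet (V := Fin n)
    rw [← h.measurableSet_image]
    exact Set.toFinite _ |>.measurableSet

lemma gnp_real_eq {c : ℝ} (hc : 0 ≤ c) (hcn : c ≤ n) (S : Set (SimpleGraph (Fin n))) :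
    (gnp n c).real S = bernProb (c / n) univ (fun A ↦ edgeGraph A ∈ S) := by
  classical
  have hp0 : 0 ≤ c / n := by positivity
  have hp1 : c / n ≤ 1 := div_le_one_of_le₀ hcn (by positivity)
  have : IsProbabilityMeasure (gnp n c) := by
    rw [gnp]
    infer_instance
  have hsing : ∀ A : Finset (Edge (Fin n)), (gnp n c).real {edgeGraph A} =
      (c / n) ^ #A * (1 - c / n) ^ #(univ \ A) := by
    intro A
    rw [gnp, measureReal_def, SimpleGraph.binomialRandom_singleton, ncard_edgeSet_edgeGraph,
      ← compl_eq_univ_sdiff, card_compl, Sym2.card_subtype_not_diag, Nat.card_eq_fintype_card]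
    have h1 : ((Set.projIcc 0 1 zero_le_one (c / n) : Set.Icc (0 : ℝ) 1) : ℝ) = c / n := by
      rw [Set.projIcc_of_mem zero_le_one ⟨hp0, hp1⟩]
    have h2 : ((Set.projIcc 0 1 zero_le_one (1 - c / n) : Set.Icc (0 : ℝ) 1) : ℝ) =
        1 - c / n := by
      rw [Set.projIcc_of_mem zero_le_one ⟨sub_nonneg.2 hp1, sub_le_self _ hp0⟩]
    simp [h1, h2]
  have hS : S = edgeGraph '' {A | edgeGraph A ∈ S} :=
    (Set.image_preimage_eq S edgeGraph_bijective.2).symm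
  have hS' : S = ((univ.filter fun A ↦ edgeGraph A ∈ S).image edgeGraph :
      Finset (SimpleGraph (Fin n))) := by
    rw [coe_image, coe_filter]
    simpa using hS
  conv_lhs => rw [hS']
  rw [← sum_measureReal_singleton, sum_image fun A _ B _ h ↦ edgeGraph_bijective.1 h, sum_filter,
    bernProb, bernExp, powerset_univ]
  refine sum_congr rfl fun A _ ↦ ?_
  rw [hsing]
  split_ifs <;> simp

lemma gnm_real_eq (m : ℕ) (S : Set (SimpleGraph (Fin n)))
    [DecidablePred fun A : Finset (Edge (Fin n)) ↦ edgeGraph A ∈ S] :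
    (gnm n m).real S =
      (#{A ∈ powersetCard m (univ : Finset (Edge (Fin n))) | edgeGraph A ∈ S} : ℝ) /
        (Fintype.card (Edge (Fin n))).choose m := by
  classical
  set P := powersetCard m (univ : Finset (Edge (Fin n)))
  have hH : {G : SimpleGraph (Fin n) | G.edgeSet.ncard = m} =
      (P.image edgeGraph : Finset (SimpleGraph (Fin n))) := by
    ext G
    obtain ⟨A, rfl⟩ := edgeGraph_bijective.2 G
    simp [P, ncard_edgeSet_edgeGraph, edgeGraph_bijective.1.eq_iff]
  have hS : S = ((univ.filter fun A ↦ edgeGraph A ∈ S).image edgeGraph :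
      Finset (SimpleGraph (Fin n))) := by
    rw [coe_image, coe_filter]
    have : S = edgeGraph '' {A | edgeGraph A ∈ S} :=
      (Set.image_preimage_eq S edgeGraph_bijective.2).symm
    simpa using this
  conv_lhs => rw [hS]
  rw [gnm, hH, measureReal_def, ProbabilityTheory.uniformOn_apply_finset,
    ← image_inter _ _ edgeGraph_bijective.1, card_image_of_injective _ edgeGraph_bijective.1,
    card_image_of_injective _ edgeGraph_bijective.1, inter_filter, inter_univ]
  simp [P]

end Transfer

/-! ### Binomial versus uniform random sets -/

section Uniform

open Finset FinsetFamily

variable {E : Type*} [Fintype E] [DecidableEq E] {Q : Finset E → Prop} [DecidablePred Q]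

/-- By the local LYM inequality, the proportion of `m`-sets in a down-closed family decreases
with `m`. -/
lemma card_div_choose_antitone (hQ : ∀ A B, A ⊆ B → Q B → Q A) :
    Antitone fun m ↦ (#{A ∈ powersetCard m (univ : Finset E) | Q A} : ℝ) /
      (Fintype.card E).choose m := by
  refine antitone_nat_of_succ_le fun m ↦ ?_
  have h := local_lubell_yamamoto_meshalkin_inequality_div (𝕜 := ℝ) (Nat.succ_ne_zero m)
    (𝒜 := {A ∈ powersetCard (m + 1) (univ : Finset E) | Q A})
    (fun A hA ↦ (mem_powersetCard.1 (mem_filter.1 hA).1).2)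
  refine h.trans ?_
  rw [Nat.succ_eq_add_one, Nat.add_sub_cancel]
  gcongr
  intro A hA
  obtain ⟨B, hB, e, he, rfl⟩ := mem_shadow_iff.1 hA
  obtain ⟨hB, hQB⟩ := mem_filter.1 hB
  refine mem_filter.2 ⟨mem_powersetCard.2 ⟨subset_univ _, ?_⟩, hQ _ _ (erase_subset e B) hQB⟩
  rw [card_erase_of_mem he, (mem_powersetCard.1 hB).2, Nat.add_sub_cancel]

/-- Comparison of the binomial and the uniform model for a down-closed property. -/
lemma bernProb_le_add {p : ℝ} (hp0 : 0 ≤ p) (hp1 : p ≤ 1) (hQ : ∀ A B, A ⊆ B → Q B → Q A) (m : ℕ) :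
    bernProb p univ Q ≤ bernProb p univ (fun A : Finset E ↦ #A < m) +
      (#{A ∈ powersetCard m (univ : Finset E) | Q A} : ℝ) / (Fintype.card E).choose m := by
  set u : ℕ → ℝ := fun m ↦ (#{A ∈ powersetCard m (univ : Finset E) | Q A} : ℝ) /
      (Fintype.card E).choose m with hu
  have hanti : Antitone u := card_div_choose_antitone hQ
  have hp1' := sub_nonneg.2 hp1
  have hu0 : ∀ m, 0 ≤ u m := fun m ↦ by positivity
  change _ ≤ _ + u m
  rw [← bernExp_const (p := p) (s := (univ : Finset E)) (u m), bernProb, bernProb, ← bernExp_add,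
    bernExp, bernExp, sum_powerset, sum_powerset]
  refine sum_le_sum fun M hM ↦ ?_
  rcases lt_or_ge M m with h | h
  · refine sum_le_sum fun A hA ↦ ?_
    have hA := (mem_powersetCard.1 hA).2
    refine mul_le_mul_of_nonneg_left ?_ (by positivity)
    rw [if_pos (hA.trans_lt h)]
    have := hu0 m
    split_ifs <;> linarith
  · have hcard : ∀ A ∈ powersetCard M (univ : Finset E), #(univ \ A) = Fintype.card E - M := by
      intro A hA
      rw [← compl_eq_univ_sdiff, card_compl, (mem_powersetCard.1 hA).2]
    have hC : ((#{A ∈ powersetCard M (univ : Finset E) | Q A} : ℕ) : ℝ) ≤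
        (Fintype.card E).choose M * u m := by
      have hC0 : (0 : ℝ) < (Fintype.card E).choose M := by
        exact_mod_cast Nat.choose_pos (Nat.lt_succ_iff.1 (mem_range.1 hM))
      have := hanti h
      rw [mul_comm]
      exact (div_le_iff₀ hC0).1 this
    calc _ = ∑ A ∈ powersetCard M (univ : Finset E),
          p ^ M * (1 - p) ^ (Fintype.card E - M) * (if Q A then 1 else 0) := by
          refine sum_congr rfl fun A hA ↦ ?_
          rw [hcard A hA, (mem_powersetCard.1 hA).2]
          congr
      _ = p ^ M * (1 - p) ^ (Fintype.card E - M) *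
          (#{A ∈ powersetCard M (univ : Finset E) | Q A} : ℝ) := by
          rw [← mul_sum, sum_boole]
      _ ≤ p ^ M * (1 - p) ^ (Fintype.card E - M) * ((Fintype.card E).choose M * u m) := by gcongr
      _ = ∑ A ∈ powersetCard M (univ : Finset E),
          p ^ M * (1 - p) ^ (Fintype.card E - M) * u m := by
          rw [sum_const, card_powersetCard, card_univ, nsmul_eq_mul]
          ring
      _ ≤ _ := by
          refine sum_le_sum fun A hA ↦ ?_
          rw [hcard A hA, (mem_powersetCard.1 hA).2]
          refine mul_le_mul_of_nonneg_left ?_ (by positivity)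
          exact le_add_of_nonneg_left (by split_ifs <;> simp)

end Uniform

/-! ### High probability statements -/

section HighProbability

open Finset

/-- Both tails (the sign `σ`) of a function of the edges of `G(n, c / n)` that changes by at most `1`
per edge decay exponentially in `n` at linear deviations. -/
lemma exists_exp_decay {c ε : ℝ} (hc : 0 < c) (hε : 0 < ε) :
    ∃ D > 0, ∀ n : ℕ, c ≤ n → ∀ (f : Finset (Edge (Fin n)) → ℝ) (σ : ℝ), |σ| = 1 →
      (∀ A e, |f (insert e A) - f A| ≤ 1) → ∀ Q : Finset (Edge (Fin n)) → Prop,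
      (∀ A, Q A → ε * n ≤ σ * (f A - bernExp (c / n) univ f)) →
        bernProb (c / n) univ Q ≤ Real.exp (-(D * n)) := by
  -- `l` minimises the Chernoff exponent `-l ε + c l² / 2` up to the constraint `l ≤ 1`
  set l := min 1 (ε / c) with hl
  have hl0 : 0 < l := lt_min one_pos (by positivity)
  have hlc : l * c ≤ ε := by
    rw [← le_div_iff₀ hc]
    exact min_le_right _ _
  refine ⟨l * ε / 2, by positivity, fun n hcn f σ hσ hf Q hQ ↦ ?_⟩
  have hn : (0 : ℝ) < n := hc.trans_le hcn
  have hp1 : c / n ≤ 1 := (div_le_one hn).2 hcn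
  have hl1 : |l * σ| ≤ 1 := by
    rw [abs_mul, hσ, mul_one, abs_of_pos hl0]
    exact min_le_left _ _
  refine (bernProb_le_exp (t := l * (ε * n)) (by positivity) hp1 hl1 hf fun A _ hA ↦ ?_).trans ?_
  · rw [mul_assoc]
    exact mul_le_mul_of_nonneg_left (hQ A hA) hl0.le
  · apply Real.exp_le_exp.2
    have hσ2 : σ ^ 2 = 1 := by rw [← sq_abs, hσ, one_pow]
    have e : (#(univ : Finset (Edge (Fin n))) : ℝ) * (c / n) * (l * σ) ^ 2 =
        (n - 1) / 2 * (l * (l * c)) := by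
      rw [card_univ, card_edge, mul_pow, hσ2]
      field_simp
    have h1 : (n - 1) / 2 * (l * (l * c)) ≤ n / 2 * (l * ε) := by
      have h2 : l * (l * c) ≤ l * ε := mul_le_mul_of_nonneg_left hlc hl0.le
      have h3 : 0 ≤ l * (l * c) := by positivity
      nlinarith
    rw [e]
    linarith

lemma mem_hasIndepSetOfDensity {n : ℕ} {α : ℝ} {G : SimpleGraph (Fin n)} :
    G ∈ HasIndepSetOfDensity n α ↔ α * n ≤ G.indepNum := by
  rw [HasIndepSetOfDensity, Set.mem_ofPred, exists_isNIndepSet_iff, Nat.ceil_le]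

lemma eventually_exp_lt_inv_sq {D K : ℝ} (hD : 0 < D) :
    ∀ᶠ n : ℕ in atTop, Real.exp (-(D * n)) < Real.exp (-K) / ((n : ℝ) + 1) ^ 2 := by
  have h1 : Tendsto (fun n : ℕ ↦ D * ((n : ℝ) + 1)) atTop atTop :=
    (tendsto_atTop_add_const_right _ _ tendsto_natCast_atTop_atTop).const_mul_atTop hD
  have h2 := (Real.tendsto_pow_mul_exp_neg_atTop_nhds_zero 2).comp h1
  have h3 : 0 < D ^ 2 * Real.exp (-D) * Real.exp (-K) := by positivity
  filter_upwards [h2.eventually_lt_const h3] with n hn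
  rw [lt_div_iff₀ (by positivity)]
  have e : Real.exp (-(D * ((n : ℝ) + 1))) = Real.exp (-(D * n)) * Real.exp (-D) := by
    rw [← Real.exp_add]
    congr 1
    ring
  simp only [Function.comp_apply, e] at hn
  refine lt_of_mul_lt_mul_left (a := D ^ 2 * Real.exp (-D)) ?_ (by positivity)
  linarith

lemma tendsto_exp_neg_mul_natCast {D : ℝ} (hD : 0 < D) :
    Tendsto (fun n : ℕ ↦ Real.exp (-(D * n))) atTop (𝓝 0) :=
  Real.tendsto_exp_neg_atTop_nhds_zero.comp
    (tendsto_natCast_atTop_atTop.const_mul_atTop hD)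

/-- Boosting: if an independent set of density `a` exists with probability at least an inverse
polynomial, then independent sets of any smaller density exist with high probability. -/
lemma tendsto_bernProb_of_inv_sq_le {α a c K : ℝ} (hα : α < a) (hc : 0 < c)
    (h : ∀ᶠ n : ℕ in atTop, Real.exp (-K) / ((n : ℝ) + 1) ^ 2 ≤ bernProb (c / n) univ
      (fun A : Finset (Edge (Fin n)) ↦ ∃ S, (edgeGraph A).IsNIndepSet ⌈a * n⌉₊ S)) :
    Tendsto (fun n : ℕ ↦ bernProb (c / n) univ
      (fun A : Finset (Edge (Fin n)) ↦ edgeGraph A ∈ HasIndepSetOfDensity n α)) atTop (𝓝 1) := by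
  have hε : 0 < (a - α) / 2 := by linarith
  obtain ⟨D, hD, hdecay⟩ := exists_exp_decay hc hε
  have hlow : ∀ᶠ n : ℕ in atTop, 1 - Real.exp (-(D * n)) ≤ bernProb (c / n) univ
      (fun A : Finset (Edge (Fin n)) ↦ edgeGraph A ∈ HasIndepSetOfDensity n α) := by
    filter_upwards [h, eventually_exp_lt_inv_sq (K := K) hD,
      tendsto_natCast_atTop_atTop.eventually_ge_atTop c] with n h1 h2 hcn
    set f : Finset (Edge (Fin n)) → ℝ := fun A ↦ (edgeGraph A).indepNum with hf
    set M := bernExp (c / n) univ f with hM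
    -- otherwise the upper tail bound contradicts the inverse polynomial lower bound
    have hmean : a * n < M + (a - α) / 2 * n := by
      by_contra! hcon
      refine (h2.trans_le h1).not_ge (hdecay n hcn f 1 (by simp) abs_indepNum_insert_sub_le _ ?_)
      intro A hA
      have := Nat.ceil_le.1 (exists_isNIndepSet_iff.1 hA)
      simp only [hf]
      linarith
    have hnot := hdecay n hcn f (-1) (by simp) abs_indepNum_insert_sub_le
      (fun A ↦ ¬ edgeGraph A ∈ HasIndepSetOfDensity n α) ?_
    · have := bernProb_add_bernProb_not (p := c / n) (s := univ)
        (Q := fun A : Finset (Edge (Fin n)) ↦ edgeGraph A ∈ HasIndepSetOfDensity n α)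
      linarith
    · intro A hA
      rw [mem_hasIndepSetOfDensity, not_le] at hA
      simp only [hf]
      linarith
  have hup : ∀ᶠ n : ℕ in atTop, bernProb (c / n) univ
      (fun A : Finset (Edge (Fin n)) ↦ edgeGraph A ∈ HasIndepSetOfDensity n α) ≤ 1 := by
    filter_upwards [tendsto_natCast_atTop_atTop.eventually_ge_atTop c] with n hcn
    have hn : (0 : ℝ) < n := hc.trans_le hcn
    rw [← bernExp_const (p := c / n) (s := (univ : Finset (Edge (Fin n)))) 1]
    exact bernExp_mono (by positivity) ((div_le_one hn).2 hcn) fun A _ ↦ by split_ifs <;> simp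
  have hl := (tendsto_exp_neg_mul_natCast hD).const_sub 1
  rw [sub_zero] at hl
  exact tendsto_of_tendsto_of_tendsto_of_le_of_le' hl tendsto_const_nhds hlow hup

/-- Transfer from `G(n, p = d / n)` to `G(n, m = c n / 2)` for `c < d`. -/
lemma tendsto_gnm_of_tendsto_bernProb {α c d : ℝ} (hd : 0 < d) (hcd : c < d)
    (h : Tendsto (fun n : ℕ ↦ bernProb (d / n) univ
      (fun A : Finset (Edge (Fin n)) ↦ edgeGraph A ∈ HasIndepSetOfDensity n α)) atTop (𝓝 1)) :
    Tendsto (fun n : ℕ ↦ (gnm n ⌈c * n / 2⌉₊).real (HasIndepSetOfDensity n α)) atTop (𝓝 1) := by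
  classical
  have hε : 0 < (d - c) / 4 := by linarith
  obtain ⟨D, hD, hdecay⟩ := exists_exp_decay hd hε
  have hl := h.sub (tendsto_exp_neg_mul_natCast hD)
  rw [sub_zero] at hl
  refine tendsto_of_tendsto_of_tendsto_of_le_of_le' hl tendsto_const_nhds ?_
    (.of_forall fun n ↦ ?_)
  · filter_upwards [tendsto_natCast_atTop_atTop.eventually_ge_atTop d,
      (tendsto_natCast_atTop_atTop.const_mul_atTop hε).eventually_ge_atTop (d / 2)] with n hdn hn2
    have hn : (0 : ℝ) < n := hd.trans_le hdn
    have hanti : ∀ A B : Finset (Edge (Fin n)), A ⊆ B →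
        edgeGraph B ∈ HasIndepSetOfDensity n α → edgeGraph A ∈ HasIndepSetOfDensity n α := by
      intro A B hAB hB
      rw [mem_hasIndepSetOfDensity] at hB ⊢
      exact hB.trans (by exact_mod_cast indepNum_anti (edgeGraph_mono hAB))
    have h1 := bernProb_le_add (p := d / n) (by positivity) ((div_le_one hn).2 hdn) hanti
      ⌈c * n / 2⌉₊
    rw [← gnm_real_eq] at h1
    have h2 := hdecay n hdn (fun A ↦ (#A : ℝ)) (-1) (by simp) ?_
      (fun A ↦ #A < ⌈c * n / 2⌉₊) ?_
    · linarith
    · intro A e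
      have h3 : (#A : ℝ) ≤ #(insert e A) := by exact_mod_cast card_le_card (subset_insert e A)
      have h4 : (#(insert e A) : ℝ) ≤ #A + 1 := by exact_mod_cast card_insert_le e A
      rw [abs_le]
      constructor <;> linarith
    · intro A hA
      rw [Nat.lt_ceil] at hA
      have e : d / n * (n * (n - 1) / 2) = d * (n - 1) / 2 := by field_simp
      rw [bernExp_card, card_univ, card_edge, e]
      linarith
  · rw [gnm_real_eq]
    refine div_le_one_of_le₀ ?_ (by positivity)
    rw [← card_univ, ← card_powersetCard]
    exact_mod_cast card_filter_le _ _

/-- Whenever `α` is small, independent sets of density `α` exist with high probability for some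
average degree `d` strictly above `cLower x α`. The room between `4 / e` and `x` provides both
`d > cLower x α` and a density slightly above `α` to which the second moment applies. -/
lemma exists_tendsto_bernProb {x : ℝ} (hx : 4 / Real.exp 1 < x) :
    ∃ α₀ : ℝ, 0 < α₀ ∧ ∀ α : ℝ, 0 < α → α < α₀ → ∃ d, 0 < d ∧ cLower x α < d ∧
      Tendsto (fun n : ℕ ↦ bernProb (d / n) univ
        (fun A : Finset (Edge (Fin n)) ↦ edgeGraph A ∈ HasIndepSetOfDensity n α)) atTop (𝓝 1) := by
  obtain ⟨y, hy, hyx⟩ := exists_between hx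
  obtain ⟨a₀, ha₀, ha₀4, H⟩ := exists_le_overlapRate hy
  refine ⟨a₀, ha₀, fun α hα hαa ↦ ?_⟩
  have hlt : cLower x α < cLower y α := by
    have : y / √α < x / √α := by gcongr
    rw [cLower, cLower]
    linarith
  obtain ⟨d, hd, hdy⟩ := exists_between (max_lt (H α hα hαa).1 hlt)
  obtain ⟨hd0, hdx⟩ := max_lt_iff.1 hd
  refine ⟨d, hd0, hdx, ?_⟩
  have hcont : ContinuousAt (cLower y) α := by
    have h1 : (1 : ℝ) / α ≠ 0 := by positivity
    have h2 : √α ≠ 0 := by positivity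
    unfold cLower
    fun_prop (disch := first | assumption | exact hα.ne')
  have hU : ∀ᶠ a in 𝓝 α, d < cLower y a ∧ 0 < a ∧ a < a₀ :=
    (hcont.eventually_const_lt hdy).and ((lt_mem_nhds hα).and (gt_mem_nhds hαa))
  obtain ⟨r, hr, hball⟩ := Metric.eventually_nhds_iff_ball.1 hU
  have hmem : α + r / 2 ∈ Metric.ball α r := by
    rw [Metric.mem_ball, Real.dist_eq, add_sub_cancel_left, abs_of_pos (by positivity)]
    linarith
  refine tendsto_bernProb_of_inv_sq_le (a := α + r / 2) (K := 2 * d ^ 2 + d / 2) (by linarith)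
    hd0 ?_
  have hk := ((tendsto_nat_ceil_mul_div_atTop (R := ℝ) (a := α + r / 2) (by positivity)).comp
    tendsto_natCast_atTop_atTop).eventually (Metric.isOpen_ball.mem_nhds hmem)
  filter_upwards [hk, tendsto_natCast_atTop_atTop.eventually_ge_atTop (2 * d)] with n hn hdn
  obtain ⟨hdl, hk0, hka⟩ := hball _ hn
  simp only [Function.comp_apply] at hdl hk0 hka
  have hn0 : (0 : ℝ) < n := by linarith
  have hk1 : 0 < ⌈(α + r / 2) * n⌉₊ := by
    rw [Nat.ceil_pos]
    positivity
  have hk2 : 2 * ⌈(α + r / 2) * n⌉₊ ≤ n := by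
    rw [div_lt_iff₀ hn0] at hka
    have : (2 * ⌈(α + r / 2) * n⌉₊ : ℝ) ≤ n := by nlinarith
    exact_mod_cast this
  refine le_bernProb_indepSet hk1 hk2 hd0.le hdn fun j hj ↦ ?_
  refine (H _ hk0 hka).2 _ d (by positivity) ?_ hd0.le hdl.le
  have : (j : ℝ) ≤ ⌈(α + r / 2) * n⌉₊ := by exact_mod_cast hj
  gcongr

end HighProbability

/-! ### Critical density and critical degree -/

lemma bddAbove_tendsto_hasIndepSet (c : ℝ) :
    BddAbove {α : ℝ | Tendsto (fun n : ℕ => (gnp n c).real (HasIndepSetOfDensity n α))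
      atTop (𝓝 1)} := by
  refine ⟨1, fun α hα ↦ ?_⟩
  by_contra! h
  have h0 : Tendsto (fun n : ℕ => (gnp n c).real (HasIndepSetOfDensity n α)) atTop (𝓝 0) := by
    refine tendsto_const_nhds.congr' ?_
    filter_upwards [eventually_gt_atTop 0] with n hn
    have : HasIndepSetOfDensity n α = ∅ := by
      refine Set.eq_empty_iff_forall_notMem.2 fun G hG ↦ ?_
      obtain ⟨S, hS⟩ := hG
      have h1 := Nat.le_ceil (α * n)
      rw [← hS.2] at h1
      have h2 : (S.card : ℝ) ≤ n := by exact_mod_cast S.card_le_univ.trans (by simp)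
      have h3 : (0 : ℝ) < n := by exact_mod_cast hn
      nlinarith
    rw [this, measureReal_empty]
  exact zero_ne_one (tendsto_nhds_unique h0 hα)

/-- For every constant `x > 4 / e` and all sufficiently small `α > 0`, the critical average degree
is at least `cLower x α`; moreover for every `0 ≤ c ≤ cLower x α`, `G(n, m = c n / 2)` has an
independent set of size `α n` with high probability (both sizes rounded up). -/
theorem theorem1 (x : ℝ) (hx : 4 / Real.exp 1 < x) :
    ∃ α₀ : ℝ, 0 < α₀ ∧ ∀ α : ℝ, 0 < α → α < α₀ →
      ((cLower x α : ℝ) : EReal) ≤ cCrit α ∧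
      ∀ c : ℝ, 0 ≤ c → c ≤ cLower x α →
        Tendsto (fun n : ℕ => (gnm n ⌈c * n / 2⌉₊).real (HasIndepSetOfDensity n α))
          atTop (𝓝 1) := by
  obtain ⟨α₀, hα₀, H⟩ := exists_tendsto_bernProb hx
  refine ⟨α₀, hα₀, fun α hα hαα₀ ↦ ?_⟩
  obtain ⟨d, hd, hxd, hlim⟩ := H α hα hαα₀
  refine ⟨?_, fun c _ hcx ↦ tendsto_gnm_of_tendsto_bernProb hd (hcx.trans_lt hxd) hlim⟩
  have hα : α ≤ alphaCrit d := by
    refine le_csSup (bddAbove_tendsto_hasIndepSet d) (hlim.congr' ?_)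
    filter_upwards [tendsto_natCast_atTop_atTop.eventually_ge_atTop d] with n hdn
    exact (gnp_real_eq hd.le hdn _).symm
  exact (EReal.coe_le_coe_iff.2 hxd.le).trans (le_sSup ⟨d, ⟨hd.le, hα⟩, rfl⟩)
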